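/- Let $\mathscr G$ be an ample groupoid, that is, a topological groupoid whose unit space $\mathscr G^{(0)}$ is locally compact and Hausdorff with a basis of compact open sets and whose range map is a local homeomorphism ($\mathscr G$ itself need not be Hausdorff). Write $\boldsymbol d(\gamma)=\gamma^{-1}\gamma$ and $\boldsymbol r(\gamma)=\gamma\gamma^{-1}$ for the source and range of $\gamma$. A bisection is a set of arrows on which $\boldsymbol d$ and $\boldsymbol r$ are injective. Let $\mathcal O=(E,p,\alpha)$ be a $\mathscr G$-sheaf of fields: $p\colon E\to\mathscr G^{(0)}$ is a local homeomorphism, each stalk $\mathcal O_x=p^{-1}(x)$ is a field, addition and multiplication are continuous on $E\times_{p,p}E$, the unit section $x\mapsto 1_x$ is continuous, and $\alpha\colon \mathscr G\times_{\boldsymbol d,p}E\to E$, $(\gamma,e)\mapsto\alpha_\gamma(e)$, is a continuous action of $\mathscr G$ by ring homomorphisms $\alpha_\gamma\colon\mathcal O_{\boldsymbol d(\gamma)}\to\mathcal O_{\boldsymbol r(\gamma)}$ (so $\alpha_x=\mathrm{id}$ for $x\in\mathscr G^{(0)}$, and $\alpha_\beta\alpha_\gamma=\alpha_{\beta\gamma}$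 whenever $\boldsymbol d(\beta)=\boldsymbol r(\gamma)$). Let $\Gamma_c(\mathscr G,\mathcal O)$ be the ring (not necessarily unital) whose additive group is generated, under pointwise addition, by the maps $f\colon\mathscr G\to E$ with $p\circ f=\boldsymbol r$ for which there is a compact open bisection $U$ such that $f|_U$ is continuous and $f$ is zero off $U$, with the convolution product $(f*g)(\gamma)=\sum_{\beta\rho=\gamma}f(\beta)\,\alpha_\beta(g(\rho))$. Let $\Gamma_c(\mathscr G^{(0)},\mathcal O)$ be the subring generated additively by such maps $f$ with $U\subseteq\mathscr G^{(0)}$. Suppose that $\Gamma_c(\mathscr G^{(0)},\mathcal O)$ is a maximal commutative subring of $\Gamma_c(\mathscr G,\mathcal O)$. Then $\Gamma_c(\mathscr G,\mathcal O)$ is left primitive, i.e. has a faithful simple left module, if and only if $\mathscr G^{(0)}$ has a dense orbit, i.e. there is $x\in\mathscr G^{(0)}$ such that $\mathrm{Orb}(x)=\{\boldsymbol r(\gamma)\mid \boldsymbol d(\gamma)=x\}$ is dense in $\mathscr G^{(0)}$. (A simple left module $M$ over a ring $R$ without unit is one with $RM\neq 0$ whose only submodules are $0$ and $M$.) -/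

import Mathlib

open CategoryTheory Topology

universe u v w

namespace GroupoidAlg

section Groupoids

variable (X : Type u) [Groupoid.{v} X]

/-- The arrow space of a groupoid. Its objects are identified with its units. -/
@[ext]
structure Arr where
  /-- the source `d(γ)` -/
  dom : X
  /-- the range `r(γ)` -/
  cod : X
  hom : dom ⟶ cod

variable {X}

/-- An arrow regarded as a point of the arrow space. -/
abbrev arr {x y : X} (f : x ⟶ y) : Arr X := ⟨x, y, f⟩

variable (X)

/-- The space of composable pairs `(snd, fst)`, whose product is `snd · fst` (first `fst`, then
`snd`), written `fst ≫ snd` in Mathlib. -/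
structure ComposablePair where
  {x : X}
  {y : X}
  {z : X}
  fst : x ⟶ y
  snd : y ⟶ z

variable {X}

/-- The product of a composable pair. -/
def ComposablePair.mul (q : ComposablePair X) : Arr X := arr (q.fst ≫ q.snd)

/-- A composable pair as a pair of arrows. -/
def ComposablePair.toProd (q : ComposablePair X) : Arr X × Arr X := (arr q.snd, arr q.fst)

/-- Composable pairs carry the subspace topology of the product. -/
instance [TopologicalSpace (Arr X)] : TopologicalSpace (ComposablePair X) :=
  TopologicalSpace.induced ComposablePair.toProd inferInstance

/-- The unit space as a set of arrows. -/
def units (X : Type u) [Groupoid.{v} X] : Set (Arr X) := Set.range fun x : X => arr (𝟙 x)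

/-- A bisection: a set of arrows on which source and range are injective. -/
def IsBisection (B : Set (Arr X)) : Prop := Set.InjOn Arr.dom B ∧ Set.InjOn Arr.cod B

/-- The orbit `r(d⁻¹(x))` of a unit. -/
def orbit (x : X) : Set X := Arr.cod '' (Arr.dom ⁻¹' {x} : Set (Arr X))

variable (X) [TopologicalSpace X] [TopologicalSpace (Arr X)]

/-- A topological groupoid. Continuity of `x ↦ 𝟙 x` and of the source (or range) map says exactly
that the topology of `X` is the subspace topology of the unit space. -/
class IsTopologicalGroupoid : Prop where
  continuous_dom : Continuous (Arr.dom : Arr X → X)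
  continuous_cod : Continuous (Arr.cod : Arr X → X)
  continuous_id : Continuous fun x : X => arr (𝟙 x)
  continuous_mul : Continuous (ComposablePair.mul : ComposablePair X → Arr X)
  continuous_inv : Continuous fun γ : Arr X => arr (Groupoid.inv γ.hom)

/-- An ample groupoid: an étale groupoid (locally compact Hausdorff unit space, range map a local
homeomorphism; the arrow space need not be Hausdorff) whose unit space has a basis of compact open
sets. -/
class IsAmple : Prop extends IsTopologicalGroupoid X where
  t2Space : T2Space X
  locallyCompactSpace : LocallyCompactSpace X
  isLocalHomeomorph_cod : IsLocalHomeomorph (Arr.cod : Arr X → X)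
  isTopologicalBasis : TopologicalSpace.IsTopologicalBasis {U : Set X | IsCompact U ∧ IsOpen U}

variable {X}

/-- A compact open bisection. (In an étale groupoid an open bisection is homeomorphic to a subspace
of the Hausdorff unit space, so a compact one is automatically Hausdorff.) -/
structure IsCompactOpenBisection (U : Set (Arr X)) : Prop where
  isBisection : IsBisection U
  isCompact : IsCompact U
  isOpen : IsOpen U

end Groupoids

section Sheaves

variable {X : Type u}

/-- The total space of a family of stalks. -/
@[ext]
structure Tot (F : X → Type w) where
  /-- the projection `p` -/
  pt : X
  val : F pt

/-- The fibre product of the total space with itself over `X`. -/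
structure FibrePair (F : X → Type w) where
  pt : X
  fst : F pt
  snd : F pt

def FibrePair.toProd {F : X → Type w} (q : FibrePair F) : Tot F × Tot F :=
  (⟨q.pt, q.fst⟩, ⟨q.pt, q.snd⟩)

/-- The subspace topology of the product. -/
instance {F : X → Type w} [TopologicalSpace (Tot F)] : TopologicalSpace (FibrePair F) :=
  TopologicalSpace.induced FibrePair.toProd inferInstance

/-- The fibre product of the arrow space (via the source map) and the total space. -/
structure ActPair [Groupoid.{v} X] (F : X → Type w) where
  {x : X}
  {y : X}
  hom : x ⟶ y
  val : F x

def ActPair.toProd [Groupoid.{v} X] {F : X → Type w} (q : ActPair F) : Arr X × Tot F :=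
  (arr q.hom, ⟨q.x, q.val⟩)

/-- The subspace topology of the product. -/
instance [Groupoid.{v} X] [TopologicalSpace (Arr X)] {F : X → Type w} [TopologicalSpace (Tot F)] :
    TopologicalSpace (ActPair F) :=
  TopologicalSpace.induced ActPair.toProd inferInstance

/-- A sheaf of unital rings over a topological groupoid: a space `Tot stalk` with a local
homeomorphism to the unit space, unital rings as stalks with fibrewise continuous operations and a
continuous unit section, and a continuous action of the groupoid by ring homomorphisms. -/
structure SheafOfRings (X : Type u) [Groupoid.{v} X] [TopologicalSpace X]
    [TopologicalSpace (Arr X)] where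
  stalk : X → Type w
  ring : ∀ x, Ring (stalk x)
  top : TopologicalSpace (Tot stalk)
  isLocalHomeomorph_pt : IsLocalHomeomorph (Tot.pt : Tot stalk → X)
  act : ∀ {x y : X}, (x ⟶ y) → stalk x →+* stalk y
  continuous_act : Continuous fun q : ActPair stalk => (⟨q.y, act q.hom q.val⟩ : Tot stalk)
  act_id : ∀ (x : X) (e : stalk x), act (𝟙 x) e = e
  act_comp : ∀ {x y z : X} (γ : x ⟶ y) (β : y ⟶ z) (e : stalk x),
    act β (act γ e) = act (γ ≫ β) e
  continuous_add : Continuous fun q : FibrePair stalk => (⟨q.pt, q.fst + q.snd⟩ : Tot stalk)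
  continuous_mul : Continuous fun q : FibrePair stalk => (⟨q.pt, q.fst * q.snd⟩ : Tot stalk)
  continuous_one : Continuous fun x : X => (⟨x, 1⟩ : Tot stalk)

attribute [instance] SheafOfRings.ring SheafOfRings.top

end Sheaves

section Convolution

variable {X : Type u} [Groupoid.{v} X] [TopologicalSpace X] [TopologicalSpace (Arr X)]
  (O : SheafOfRings.{u, v, w} X)

/-- A 𝒢-sheaf of fields. -/
def SheafOfRings.IsSheafOfFields : Prop := ∀ x, IsField (O.stalk x)

/-- The group of all maps `f` from arrows to the total space with `f γ` in the stalk at `r(γ)`,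
under pointwise addition. -/
abbrev Fn := ∀ γ : Arr X, O.stalk γ.cod

variable {O}

/-- The map from arrows to the total space given by an element of `Fn O`. -/
def Fn.toTot (f : Fn O) (γ : Arr X) : Tot O.stalk := ⟨γ.cod, f γ⟩

/-- `f` is supported on `U`: it is continuous on `U` and zero off `U`. -/
def SupportedOn (f : Fn O) (U : Set (Arr X)) : Prop :=
  ContinuousOn f.toTot U ∧ ∀ γ, γ ∉ U → f γ = 0

variable (O)

/-- The group generated by the maps supported on a compact open bisection contained in `H`. -/
def gammaOn (H : Set (Arr X)) : AddSubgroup (Fn O) :=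
  AddSubgroup.closure {f | ∃ U, IsCompactOpenBisection U ∧ U ⊆ H ∧ SupportedOn f U}

/-- The group `Γ_c(𝒢, 𝒪)`. -/
def Gamma : Type (max u v w) := gammaOn O Set.univ

instance : AddCommGroup (Gamma O) := inferInstanceAs (AddCommGroup (gammaOn O Set.univ))

variable {O}

/-- The factorizations `γ = β ρ`. -/
abbrev Factorization (γ : Arr X) :=
  {q : Σ y : X, (γ.dom ⟶ y) × (y ⟶ γ.cod) // q.2.1 ≫ q.2.2 = γ.hom}

/-- Convolution: the sum over `β ρ = γ` of `f(β) α_β(g(ρ))`. For `f`, `g` in `Γ_c(𝒢, 𝒪)` only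
finitely many terms are nonzero. -/
noncomputable def conv (f g : Fn O) : Fn O := fun γ =>
  ∑ᶠ q : Factorization γ, f (arr q.1.2.2) * O.act q.1.2.2 (g (arr q.1.2.1))

/-- Factorizations of `γ` are determined by their left factor. -/
def factorizationEquiv (γ : Arr X) : Factorization γ ≃ Σ y : X, (y ⟶ γ.cod) where
  toFun q := ⟨q.1.1, q.1.2.2⟩
  invFun b := ⟨⟨b.1, γ.hom ≫ Groupoid.inv b.2, b.2⟩, by simp⟩
  left_inv := by
    rintro ⟨⟨y, ρ, β⟩, h⟩
    dsimp at h
    simp [← h]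
  right_inv _ := rfl

theorem conv_apply (f g : Fn O) {x z : X} (γ : x ⟶ z) :
    conv f g (arr γ) = ∑ᶠ b : Σ y : X, (y ⟶ z),
      f (arr b.2) * O.act b.2 (g (arr (γ ≫ Groupoid.inv b.2))) := by
  unfold conv
  rw [← finsum_comp_equiv (factorizationEquiv (arr γ)).symm]
  rfl

/-- `f` is nonzero at only finitely many points of each fibre of the range map. -/
def FinFib (f : Fn O) : Prop := ∀ z : X, {b : Σ y : X, (y ⟶ z) | f (arr b.2) ≠ 0}.Finite

theorem finFib_of_mem {H : Set (Arr X)} {f : Fn O} (hf : f ∈ gammaOn O H) : FinFib f := by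
  induction hf using AddSubgroup.closure_induction with
  | mem f h =>
    obtain ⟨U, hU, -, -, h0⟩ := h
    intro z
    refine Set.Subsingleton.finite ?_
    rintro ⟨y, b⟩ hb ⟨y', b'⟩ hb'
    have h1 : arr b ∈ U := by
      by_contra hn
      exact hb (h0 _ hn)
    have h2 : arr b' ∈ U := by
      by_contra hn
      exact hb' (h0 _ hn)
    have h3 : arr b = arr b' := hU.isBisection.2 h1 h2 rfl
    cases h3
    rfl
  | zero => intro z; simp
  | add f g _ _ hf hg =>
    intro z
    refine ((hf z).union (hg z)).subset ?_
    intro b hb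
    by_contra hn
    simp only [Set.mem_union, Set.mem_ofPred_eq, not_or, not_not] at hn
    exact hb (by simp [hn.1, hn.2])
  | neg f _ hf => intro z; simpa using hf z

theorem conv_support_finite {f : Fn O} (hf : FinFib f) (g : Fn O) {x z : X} (γ : x ⟶ z) :
    (Function.support (M := O.stalk z) fun b : Σ y : X, (y ⟶ z) =>
      f (arr b.2) * O.act b.2 (g (arr (γ ≫ Groupoid.inv b.2)))).Finite :=
  (hf z).subset fun b hb h0 => hb (by simp [h0])

theorem conv_add {f : Fn O} (hf : FinFib f) (g h : Fn O) :
    conv f (g + h) = conv f g + conv f h := by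
  funext ⟨x, z, γ⟩
  simp only [Pi.add_apply]
  rw [conv_apply, conv_apply, conv_apply,
    ← finsum_add_distrib (conv_support_finite hf g γ) (conv_support_finite hf h γ)]
  simp [mul_add]

theorem add_conv {f g : Fn O} (hf : FinFib f) (hg : FinFib g) (h : Fn O) :
    conv (f + g) h = conv f h + conv g h := by
  funext ⟨x, z, γ⟩
  simp only [Pi.add_apply]
  rw [conv_apply, conv_apply, conv_apply,
    ← finsum_add_distrib (conv_support_finite hf h γ) (conv_support_finite hg h γ)]
  simp [add_mul]

theorem conv_zero (f : Fn O) : conv f 0 = 0 := by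
  funext γ; simp [conv]

theorem zero_conv (f : Fn O) : conv 0 f = 0 := by
  funext γ; simp [conv]

theorem conv_neg (f g : Fn O) : conv f (-g) = -conv f g := by
  funext γ; simp [conv, finsum_neg_distrib]

theorem neg_conv (f g : Fn O) : conv (-f) g = -conv f g := by
  funext γ; simp [conv, finsum_neg_distrib]

/-- Post-composition with `δ` permutes the arrows over a fixed range. -/
def postEquiv {y z : X} (δ : y ⟶ z) : (Σ x : X, (x ⟶ y)) ≃ Σ x : X, (x ⟶ z) where
  toFun b := ⟨b.1, b.2 ≫ δ⟩
  invFun b := ⟨b.1, b.2 ≫ Groupoid.inv δ⟩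
  left_inv b := by simp
  right_inv b := by simp

theorem conv_assoc {f g h : Fn O} (hf : FinFib f) (hg : FinFib g) :
    conv (conv f g) h = conv f (conv g h) := by
  funext ⟨x, z, γ⟩
  let I := Σ y : X, (y ⟶ z)
  let T : I → I → O.stalk z := fun b d =>
    f (arr d.2) * O.act d.2 (g (arr (b.2 ≫ Groupoid.inv d.2))) *
      O.act b.2 (h (arr (γ ≫ Groupoid.inv b.2)))
  have hL : conv (conv f g) h (arr γ) = ∑ᶠ b : I, ∑ᶠ d : I, T b d := by
    rw [conv_apply]
    refine finsum_congr fun b => ?_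
    rw [conv_apply, finsum_mul' _ _ (conv_support_finite hf g b.2)]
  have hR : conv f (conv g h) (arr γ) = ∑ᶠ d : I, ∑ᶠ b : I, T b d := by
    rw [conv_apply]
    refine finsum_congr fun d => ?_
    rw [conv_apply, show ∀ a, O.act d.2 a = (O.act d.2 : _ →+ _) a from fun _ => rfl,
      AddMonoidHom.map_finsum _ (conv_support_finite hg h _), mul_finsum',
      ← finsum_comp_equiv (postEquiv d.2)]
    · refine finsum_congr fun b => ?_
      have h1 : (b.2 ≫ d.2) ≫ Groupoid.inv d.2 = b.2 := by simp
      have h2 : γ ≫ Groupoid.inv (b.2 ≫ d.2) =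
          (γ ≫ Groupoid.inv d.2) ≫ Groupoid.inv b.2 := by simp
      simp only [T, postEquiv, Equiv.coe_fn_mk]
      rw [h1, h2]
      simp [O.act_comp, mul_assoc]
    · refine (hg d.1).subset fun b hb h0 => hb ?_
      simp [h0]
  rw [hL, hR]
  let S : Set (I × I) := {p | f (arr p.2.2) ≠ 0 ∧ g (arr (p.1.2 ≫ Groupoid.inv p.2.2)) ≠ 0}
  have hS : S.Finite := by
    have h1 : (⋃ d ∈ {d : I | f (arr d.2) ≠ 0},
        (fun b : Σ x : X, (x ⟶ d.1) => ((postEquiv d.2 b, d) : I × I)) ''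
          {b | g (arr b.2) ≠ 0}).Finite :=
      (hf z).biUnion fun d _ => (hg d.1).image _
    refine h1.subset ?_
    rintro ⟨b, d⟩ ⟨hp, hq⟩
    simp only [Set.mem_iUnion]
    exact ⟨d, hp, (postEquiv d.2).symm b, hq, by simp⟩
  have hT : (Function.support fun p : I × I => T p.1 p.2).Finite := by
    refine hS.subset fun p hp => ⟨fun h0 => hp ?_, fun h0 => hp ?_⟩ <;> simp [T, h0]
  have hT' : (Function.support fun p : I × I => T p.2 p.1).Finite := by
    have := hT.preimage (f := Prod.swap) Prod.swap_injective.injOn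
    exact this
  rw [← finsum_curry (fun p : I × I => T p.1 p.2) hT,
    ← finsum_curry (fun p : I × I => T p.2 p.1) hT',
    ← finsum_comp_equiv (Equiv.prodComm I I)]
  rfl

theorem conv_mul_of_mem {f g : Fn O} {U : Set (Arr X)} (hU : Set.InjOn Arr.cod U)
    (hf : ∀ γ, γ ∉ U → f γ = 0) (q : ComposablePair X) (hq : arr q.snd ∈ U) :
    conv f g q.mul = f (arr q.snd) * O.act q.snd (g (arr q.fst)) := by
  obtain ⟨ρ, β⟩ := q
  rename_i x y z
  change conv f g (arr (ρ ≫ β)) = _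
  rw [conv_apply, finsum_eq_single _ (⟨y, β⟩ : Σ y : X, (y ⟶ z))]
  · have h : (ρ ≫ β) ≫ Groupoid.inv β = ρ := by simp
    dsimp only
    rw [h]
  · rintro ⟨y', β'⟩ hne
    rw [hf, zero_mul]
    intro hmem
    have h3 : arr β' = arr β := hU hmem hq rfl
    cases h3
    exact hne rfl

/-- The set `U V` of products of composable arrows. -/
def setMul (U V : Set (Arr X)) : Set (Arr X) :=
  ComposablePair.mul '' {q | arr q.snd ∈ U ∧ arr q.fst ∈ V}

theorem setMul_units : setMul (units X) (units X) ⊆ units X := by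
  rintro _ ⟨⟨ρ, β⟩, ⟨⟨x, hx⟩, ⟨y, hy⟩⟩, rfl⟩
  dsimp only at hx hy
  cases hy
  cases hx
  rename_i y
  exact ⟨y, by simp [ComposablePair.mul]⟩

theorem continuous_toProd :
    Continuous (ComposablePair.toProd : ComposablePair X → Arr X × Arr X) :=
  continuous_induced_dom

theorem continuous_snd : Continuous fun q : ComposablePair X => arr q.snd :=
  continuous_fst.comp continuous_toProd

theorem continuous_fst : Continuous fun q : ComposablePair X => arr q.fst :=
  _root_.continuous_snd.comp continuous_toProd

variable [hX : IsAmple X]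

theorem isOpenMap_snd : IsOpenMap fun q : ComposablePair X => arr q.snd := by
  intro W hW
  obtain ⟨W', hW', rfl⟩ := isOpen_induced_iff.1 hW
  rw [isOpen_iff_forall_mem_open]
  rintro _ ⟨q, hq, rfl⟩
  obtain ⟨B, A, hB, hA, hqB, hqA, hBA⟩ := isOpen_prod_iff.1 hW' _ _ hq
  refine ⟨B ∩ Arr.dom ⁻¹' (Arr.cod '' A), ?_,
    hB.inter ((hX.isLocalHomeomorph_cod.isOpenMap A hA).preimage hX.continuous_dom),
    hqB, arr q.fst, hqA, rfl⟩
  rintro ⟨y, z, β⟩ ⟨hβ, ⟨x, y', ρ⟩, hρ, hh⟩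
  dsimp at hh
  subst hh
  exact ⟨⟨ρ, β⟩, hBA ⟨hβ, hρ⟩, rfl⟩

theorem isOpenMap_mul : IsOpenMap (ComposablePair.mul : ComposablePair X → Arr X) := by
  intro W hW
  rw [isOpen_iff_forall_mem_open]
  rintro _ ⟨q, hq, rfl⟩
  obtain ⟨e, he, hee⟩ := hX.isLocalHomeomorph_cod q.mul
  set W' := W ∩ ComposablePair.mul ⁻¹' e.source with hW'
  have hWo : IsOpen W' := hW.inter (e.open_source.preimage hX.continuous_mul)
  have h1 : IsOpen (Arr.cod '' ((fun q : ComposablePair X => arr q.snd) '' W')) :=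
    hX.isLocalHomeomorph_cod.isOpenMap _ (isOpenMap_snd _ hWo)
  refine ⟨e.source ∩ Arr.cod ⁻¹' (Arr.cod '' ((fun q : ComposablePair X => arr q.snd) '' W')),
    ?_, e.open_source.inter (h1.preimage hX.continuous_cod), he, _, ⟨q, ⟨hq, he⟩, rfl⟩, rfl⟩
  rintro γ ⟨hγ, _, ⟨p, hp, rfl⟩, hpγ⟩
  refine ⟨p, hp.1, e.injOn hp.2 hγ ?_⟩
  rw [← hee]
  exact hpγ

theorem isCompactOpenBisection_setMul {U V : Set (Arr X)} (hU : IsCompactOpenBisection U)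
    (hV : IsCompactOpenBisection V) : IsCompactOpenBisection (setMul U V) where
  isBisection := by
    constructor
    · rintro _ ⟨⟨ρ, β⟩, ⟨hβ, hρ⟩, rfl⟩ _ ⟨⟨ρ', β'⟩, ⟨hβ', hρ'⟩, rfl⟩ h
      have h1 := hV.isBisection.1 hρ hρ' h
      cases h1
      have h2 := hU.isBisection.1 hβ hβ' rfl
      cases h2
      rfl
    · rintro _ ⟨⟨ρ, β⟩, ⟨hβ, hρ⟩, rfl⟩ _ ⟨⟨ρ', β'⟩, ⟨hβ', hρ'⟩, rfl⟩ h
      have h1 := hU.isBisection.2 hβ hβ' h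
      cases h1
      have h2 := hV.isBisection.2 hρ hρ' rfl
      cases h2
      rfl
  isOpen := isOpenMap_mul _
    ((hU.isOpen.preimage continuous_snd).inter (hV.isOpen.preimage continuous_fst))
  isCompact := by
    refine IsCompact.image ?_ hX.continuous_mul
    have hi : IsInducing (ComposablePair.toProd : ComposablePair X → Arr X × Arr X) := ⟨rfl⟩
    rw [hi.isCompact_iff]
    have : T2Space X := hX.t2Space
    have hc : IsClosed {p : Arr X × Arr X | p.1.dom = p.2.cod} :=
      isClosed_eq (hX.continuous_dom.comp _root_.continuous_fst)
        (hX.continuous_cod.comp _root_.continuous_snd)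
    convert (hU.isCompact.prod hV.isCompact).inter_right hc using 1
    ext ⟨⟨y, z, β⟩, ⟨x, y', ρ⟩⟩
    constructor
    · rintro ⟨q, ⟨h1, h2⟩, h⟩
      cases h
      exact ⟨⟨h1, h2⟩, rfl⟩
    · rintro ⟨⟨h1, h2⟩, h⟩
      dsimp at h
      subst h
      exact ⟨⟨ρ, β⟩, ⟨h1, h2⟩, rfl⟩

theorem supportedOn_conv {f g : Fn O} {U V : Set (Arr X)} (hU : IsCompactOpenBisection U)
    (hV : IsCompactOpenBisection V) (hf : SupportedOn f U) (hg : SupportedOn g V) :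
    SupportedOn (conv f g) (setMul U V) := by
  constructor
  · rintro _ ⟨q, ⟨hqU, hqV⟩, rfl⟩
    refine ContinuousAt.continuousWithinAt ?_
    have hm : Filter.Tendsto (fun p : ComposablePair X => (conv f g).toTot p.mul) (𝓝 q)
        (𝓝 ((conv f g).toTot q.mul)) := by
      have hPo : ∀ᶠ p : ComposablePair X in 𝓝 q, arr p.snd ∈ U :=
        continuous_snd.continuousAt.eventually (hU.isOpen.mem_nhds hqU)
      have hval : ∀ p : ComposablePair X, arr p.snd ∈ U → (conv f g).toTot p.mul =
          ⟨p.z, f (arr p.snd) * O.act p.snd (g (arr p.fst))⟩ := by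
        intro p hp
        unfold Fn.toTot
        rw [conv_mul_of_mem hU.isBisection.2 hf.2 p hp]
        rfl
      rw [hval q hqU]
      refine Filter.Tendsto.congr' (hPo.mono fun p hp => (hval p hp).symm) ?_
      have hfa : ContinuousAt (fun p : ComposablePair X => f.toTot (arr p.snd)) q :=
        ContinuousAt.comp (f := fun p : ComposablePair X => arr p.snd)
          (hf.1.continuousAt (hU.isOpen.mem_nhds hqU)) continuous_snd.continuousAt
      have hga : ContinuousAt (fun p : ComposablePair X => g.toTot (arr p.fst)) q :=
        ContinuousAt.comp (f := fun p : ComposablePair X => arr p.fst)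
          (hg.1.continuousAt (hV.isOpen.mem_nhds hqV)) continuous_fst.continuousAt
      have hact : ContinuousAt (fun p : ComposablePair X =>
          (⟨p.snd, g (arr p.fst)⟩ : ActPair O.stalk)) q := by
        have hi : IsInducing (ActPair.toProd : ActPair O.stalk → Arr X × Tot O.stalk) := ⟨rfl⟩
        rw [hi.continuousAt_iff]
        exact continuous_snd.continuousAt.prodMk hga
      have hact' : ContinuousAt (fun p : ComposablePair X =>
          (⟨p.z, O.act p.snd (g (arr p.fst))⟩ : Tot O.stalk)) q :=
        ContinuousAt.comp (f := fun p : ComposablePair X =>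
          (⟨p.snd, g (arr p.fst)⟩ : ActPair O.stalk)) O.continuous_act.continuousAt hact
      have hfib : ContinuousAt (fun p : ComposablePair X =>
          (⟨p.z, f (arr p.snd), O.act p.snd (g (arr p.fst))⟩ : FibrePair O.stalk)) q := by
        have hi : IsInducing (FibrePair.toProd : FibrePair O.stalk → Tot O.stalk × Tot O.stalk) :=
          ⟨rfl⟩
        rw [hi.continuousAt_iff]
        exact hfa.prodMk hact'
      exact ContinuousAt.comp (f := fun p : ComposablePair X =>
          (⟨p.z, f (arr p.snd), O.act p.snd (g (arr p.fst))⟩ : FibrePair O.stalk))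
        O.continuous_mul.continuousAt hfib
    exact (Filter.tendsto_map'_iff.2 hm).mono_left (isOpenMap_mul.nhds_le q)
  · rintro ⟨x, z, γ⟩ hγ
    rw [conv_apply]
    refine finsum_eq_zero_of_forall_eq_zero fun b => ?_
    by_cases h1 : arr b.2 ∈ U
    · by_cases h2 : arr (γ ≫ Groupoid.inv b.2) ∈ V
      · refine absurd ⟨⟨γ ≫ Groupoid.inv b.2, b.2⟩, ⟨h1, h2⟩, ?_⟩ hγ
        simp [ComposablePair.mul]
      · rw [hg.2 _ h2, map_zero, mul_zero]
    · rw [hf.2 _ h1, zero_mul]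

theorem conv_mem {H : Set (Arr X)} (hH : setMul H H ⊆ H) {f g : Fn O} (hf : f ∈ gammaOn O H)
    (hg : g ∈ gammaOn O H) : conv f g ∈ gammaOn O H := by
  unfold gammaOn at hf hg
  induction hf, hg using AddSubgroup.closure_induction₂ with
  | mem f g hf hg =>
    obtain ⟨U, hU, hUH, hfU⟩ := hf
    obtain ⟨V, hV, hVH, hgV⟩ := hg
    refine AddSubgroup.subset_closure ⟨setMul U V, isCompactOpenBisection_setMul hU hV, ?_,
      supportedOn_conv hU hV hfU hgV⟩
    exact Set.Subset.trans
      (by rintro _ ⟨q, hq, rfl⟩; exact ⟨q, ⟨hUH hq.1, hVH hq.2⟩, rfl⟩) hH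
  | zero_left g _ => rw [zero_conv]; exact zero_mem _
  | zero_right f _ => rw [conv_zero]; exact zero_mem _
  | add_left f f' g hf hf' hg h h' =>
    rw [add_conv (finFib_of_mem (H := H) hf) (finFib_of_mem (H := H) hf')]
    exact add_mem h h'
  | add_right g g' f hg hg' hf h h' =>
    rw [conv_add (finFib_of_mem (H := H) hf)]
    exact add_mem h h'
  | neg_left f g _ _ h => rw [neg_conv]; exact neg_mem h
  | neg_right f g _ _ h => rw [conv_neg]; exact neg_mem h

variable (O)

/-- The ring `Γ_c(𝒢, 𝒪)` (in general without unit), with convolution as multiplication. -/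
noncomputable instance : NonUnitalRing (Gamma O) where
  __ := (inferInstance : AddCommGroup (Gamma O))
  mul f g := ⟨conv f.1 g.1, conv_mem (Set.subset_univ _) f.2 g.2⟩
  left_distrib f g h := Subtype.ext (conv_add (finFib_of_mem f.2) g.1 h.1)
  right_distrib f g h := Subtype.ext (add_conv (finFib_of_mem f.2) (finFib_of_mem g.2) h.1)
  zero_mul f := Subtype.ext (zero_conv f.1)
  mul_zero f := Subtype.ext (conv_zero f.1)
  mul_assoc f g _ := Subtype.ext (conv_assoc (finFib_of_mem f.2) (finFib_of_mem g.2))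

/-- The diagonal subring `Γ_c(𝒢⁰, 𝒪)` of `Γ_c(𝒢, 𝒪)`, generated as a group by the maps supported
on a compact open set of units. -/
def diagonal : NonUnitalSubring (Gamma O) where
  carrier := {f | f.1 ∈ gammaOn O (units X)}
  add_mem' hf hg := (gammaOn O (units X)).add_mem hf hg
  zero_mem' := (gammaOn O (units X)).zero_mem
  neg_mem' hf := (gammaOn O (units X)).neg_mem hf
  mul_mem' hf hg := conv_mem (setMul_units (X := X)) hf hg

end Convolution

section RingTheory

/-- A maximal commutative subring of a ring that need not have a unit. -/
def IsMaximalCommutative {R : Type u} [NonUnitalRing R] (A : NonUnitalSubring R) : Prop :=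
  Maximal (fun B : NonUnitalSubring R => ∀ a ∈ B, ∀ b ∈ B, a * b = b * a) A

/-- A ring is left primitive if it has a faithful simple left module. A left module over a ring `R`
without unit is given by `φ : R → End(M)`; it is simple if `R M ≠ 0` and it has no submodules but
`0` and `M`. (A simple left module is a quotient of `R`, so modules in the universe of `R`
suffice.) -/
def IsLeftPrimitive (R : Type u) [NonUnitalRing R] : Prop :=
  ∃ (M : Type u) (_ : AddCommGroup M) (φ : R →ₙ+* AddMonoid.End M),
    Function.Injective φ ∧ (∃ r m, φ r m ≠ 0) ∧
      ∀ N : AddSubgroup M, (∀ r, ∀ m ∈ N, φ r m ∈ N) → N = ⊥ ∨ N = ⊤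

end RingTheory

end GroupoidAlg

/-!
Write an element of `Γ_c(𝒢, 𝒪)` as a sum of functions supported on compact open bisections.
Multiplying by `1_{U⁻¹}`, where `U` carries one of the summands, moves that summand into the
diagonal; since the diagonal is commutative, the commutator with one of its elements is a shorter
sum. Since the diagonal is *maximal* commutative, some commutator is nonzero unless the element
already lies in the diagonal. Hence every nonzero two-sided ideal meets the diagonal.

If an orbit is dense, `Γ_c(𝒢, 𝒪)` acts on the direct sum of the stalks along it. This module is
simple because the stalks are fields, and faithful because a nonzero element of the diagonal is
nonzero on an open set of units, which the orbit meets.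

Conversely, a simple module behaves like a sheaf on the unit space. Its elements whose germs vanish
along a given orbit form a submodule. If this is everything for every orbit, then the ring acts by
zero; otherwise it is `0` for some orbit, and faithfulness forces that orbit to be dense because
`1_V` maps the module into it whenever `V` misses the orbit.
-/

namespace GroupoidAlg

section Sections

variable {X : Type u} [Groupoid.{v} X] [TopologicalSpace X] [TopologicalSpace (Arr X)]
  {O : SheafOfRings.{u, v, w} X} {Z : Type*} [TopologicalSpace Z] {c : Z → X}
  {f g : ∀ z, O.stalk (c z)} {z : Z}

theorem eventually_eq_of_continuousAt
    (hf : ContinuousAt (fun z => (⟨c z, f z⟩ : Tot O.stalk)) z)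
    (hg : ContinuousAt (fun z => (⟨c z, g z⟩ : Tot O.stalk)) z) (h : f z = g z) :
    ∀ᶠ z' in 𝓝 z, f z' = g z' := by
  obtain ⟨N, hNo, hN, hinj⟩ := O.isLocalHomeomorph_pt.isLocallyInjective ⟨c z, f z⟩
  have hgN : (⟨c z, g z⟩ : Tot O.stalk) ∈ N := h ▸ hN
  filter_upwards [hf.eventually (hNo.mem_nhds hN), hg.eventually (hNo.mem_nhds hgN)]
    with z' hfz hgz
  simpa using hinj hfz hgz rfl

theorem continuousAt_fibrePair
    (hf : ContinuousAt (fun z => (⟨c z, f z⟩ : Tot O.stalk)) z)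
    (hg : ContinuousAt (fun z => (⟨c z, g z⟩ : Tot O.stalk)) z) :
    ContinuousAt (fun z => (⟨c z, f z, g z⟩ : FibrePair O.stalk)) z := by
  have hi : IsInducing (FibrePair.toProd : FibrePair O.stalk → Tot O.stalk × Tot O.stalk) := ⟨rfl⟩
  exact hi.continuousAt_iff.2 (hf.prodMk hg)

theorem continuousAt_add
    (hf : ContinuousAt (fun z => (⟨c z, f z⟩ : Tot O.stalk)) z)
    (hg : ContinuousAt (fun z => (⟨c z, g z⟩ : Tot O.stalk)) z) :
    ContinuousAt (fun z => (⟨c z, f z + g z⟩ : Tot O.stalk)) z :=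
  O.continuous_add.continuousAt.comp (f := fun z => (⟨c z, f z, g z⟩ : FibrePair O.stalk))
    (continuousAt_fibrePair hf hg)

theorem continuousAt_mul
    (hf : ContinuousAt (fun z => (⟨c z, f z⟩ : Tot O.stalk)) z)
    (hg : ContinuousAt (fun z => (⟨c z, g z⟩ : Tot O.stalk)) z) :
    ContinuousAt (fun z => (⟨c z, f z * g z⟩ : Tot O.stalk)) z :=
  O.continuous_mul.continuousAt.comp (f := fun z => (⟨c z, f z, g z⟩ : FibrePair O.stalk))
    (continuousAt_fibrePair hf hg)

theorem continuousAt_act {γ : Z → Arr X} {s : ∀ z, O.stalk (γ z).dom} (hγ : ContinuousAt γ z)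
    (hs : ContinuousAt (fun z => (⟨(γ z).dom, s z⟩ : Tot O.stalk)) z) :
    ContinuousAt (fun z => (⟨(γ z).cod, O.act (γ z).hom (s z)⟩ : Tot O.stalk)) z := by
  have hi : IsInducing (ActPair.toProd : ActPair O.stalk → Arr X × Tot O.stalk) := ⟨rfl⟩
  exact O.continuous_act.continuousAt.comp
    (f := fun z => (⟨(γ z).hom, s z⟩ : ActPair O.stalk)) (hi.continuousAt_iff.2 (hγ.prodMk hs))

theorem exists_section (x : X) (v : O.stalk x) :
    ∃ s : ∀ y, O.stalk y, s x = v ∧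
      ∀ᶠ y in 𝓝 x, ContinuousAt (fun y => (⟨y, s y⟩ : Tot O.stalk)) y := by
  let e := O.isLocalHomeomorph_pt.localInverseAt (⟨x, v⟩ : Tot O.stalk)
  have hx : x ∈ e.source := O.isLocalHomeomorph_pt.apply_self_mem_localInverseAt_source
  have hval : ∀ y, ∃ s : O.stalk y, y ∈ e.source → e y = ⟨y, s⟩ := by
    intro y
    by_cases hy : y ∈ e.source
    · have hpt : (e y).pt = y := O.isLocalHomeomorph_pt.apply_localInverseAt_of_mem hy
      generalize e y = t at hpt
      subst hpt
      exact ⟨t.val, fun _ => rfl⟩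
    · exact ⟨0, fun h => absurd h hy⟩
  choose s hs using hval
  refine ⟨s, ?_, ?_⟩
  · have hex : e x = ⟨x, v⟩ := O.isLocalHomeomorph_pt.localInverseAt_apply_self
    simpa using (hs x hx).symm.trans hex
  · filter_upwards [e.open_source.mem_nhds hx] with y hy
    refine (e.continuousAt hy).congr ?_
    filter_upwards [e.open_source.mem_nhds hy] with y' hy'
    exact hs y' hy'

theorem continuous_zero_section : Continuous fun x : X => (⟨x, 0⟩ : Tot O.stalk) := by
  refine continuous_iff_continuousAt.2 fun x => ?_
  obtain ⟨s, hsx, hs⟩ := exists_section (O := O) x 0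
  refine hs.self_of_nhds.congr ?_
  filter_upwards [eventually_eq_of_continuousAt (continuousAt_add hs.self_of_nhds hs.self_of_nhds)
    hs.self_of_nhds (by simp [hsx])] with y hy
  simpa using hy

theorem continuousAt_neg (hf : ContinuousAt (fun z => (⟨c z, f z⟩ : Tot O.stalk)) z) :
    ContinuousAt (fun z => (⟨c z, -f z⟩ : Tot O.stalk)) z := by
  have hc : ContinuousAt c z := O.isLocalHomeomorph_pt.continuous.continuousAt.comp hf
  obtain ⟨s, hsz, hs⟩ := exists_section (O := O) (c z) (-f z)
  have hsc : ContinuousAt (fun z => (⟨c z, s (c z)⟩ : Tot O.stalk)) z :=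
    hs.self_of_nhds.comp (f := c) hc
  have h0 : ContinuousAt (fun z => (⟨c z, 0⟩ : Tot O.stalk)) z :=
    continuous_zero_section.continuousAt.comp (f := c) hc
  refine hsc.congr ?_
  filter_upwards [eventually_eq_of_continuousAt (continuousAt_add hsc hf) h0 (by simp [hsz])]
    with z' hz'
  rw [eq_neg_of_add_eq_zero_left hz']

theorem eventually_ne_zero (hO : O.IsSheafOfFields) {f : ∀ x, O.stalk x} {x : X}
    (hf : ContinuousAt (fun x => (⟨x, f x⟩ : Tot O.stalk)) x) (h : f x ≠ 0) :
    ∀ᶠ y in 𝓝 x, f y ≠ 0 := by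
  obtain ⟨b, hb⟩ := (hO x).mul_inv_cancel h
  obtain ⟨s, hsx, hs⟩ := exists_section (O := O) x b
  filter_upwards [eventually_eq_of_continuousAt (continuousAt_mul hf hs.self_of_nhds)
    O.continuous_one.continuousAt (by simp [hsx, hb])] with y hy h0
  have := (hO y).nontrivial
  simp [h0] at hy

end Sections

section ArrowSpace

open TopologicalSpace (CompactOpens)

variable {X : Type u} [Groupoid.{v} X]

/-- The units at the points of `V`. -/
def unitSet (V : Set X) : Set (Arr X) := (fun x : X => arr (𝟙 x)) '' V

theorem unitSet_subset_units (V : Set X) : unitSet V ⊆ units X := Set.image_subset_range _ _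

@[simp]
theorem arr_id_mem_unitSet {V : Set X} {x : X} : arr (𝟙 x) ∈ unitSet V ↔ x ∈ V :=
  Function.Injective.mem_set_image fun _ _ h => congrArg Arr.dom h

theorem isBisection_units : IsBisection (units X) := by
  constructor <;> (rintro _ ⟨x, rfl⟩ _ ⟨y, rfl⟩ h; cases h; rfl)

/-- The set `U⁻¹` of inverses of the arrows in `U`. -/
def setInv (U : Set (Arr X)) : Set (Arr X) := {γ | arr (Groupoid.inv γ.hom) ∈ U}

theorem arr_inv_mem_setInv {U : Set (Arr X)} {x y : X} {γ : x ⟶ y} :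
    arr (Groupoid.inv γ) ∈ setInv U ↔ arr γ ∈ U := by
  simp [setInv]

theorem IsBisection.setMul_setInv_subset_units {U : Set (Arr X)} (hU : IsBisection U) :
    setMul U (setInv U) ⊆ units X := by
  rintro _ ⟨⟨ρ, β⟩, ⟨hβ, hρ⟩, rfl⟩
  have h : arr (Groupoid.inv ρ) = arr β := hU.1 hρ hβ rfl
  cases h
  rw [ComposablePair.mul, Groupoid.comp_inv]
  exact ⟨_, rfl⟩

theorem mem_orbit {x y : X} : y ∈ orbit x ↔ Nonempty (x ⟶ y) := by
  constructor
  · rintro ⟨⟨_, _, γ⟩, rfl, rfl⟩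
    exact ⟨γ⟩
  · rintro ⟨γ⟩
    exact ⟨arr γ, rfl, rfl⟩

theorem dom_mem_orbit {x : X} {γ : Arr X} (h : γ.cod ∈ orbit x) : γ.dom ∈ orbit x :=
  (mem_orbit.1 h).elim fun δ => mem_orbit.2 ⟨δ ≫ Groupoid.inv γ.hom⟩

variable [TopologicalSpace X] [TopologicalSpace (Arr X)] [hX : IsAmple X]

/-- Inversion of arrows as a homeomorphism of the arrow space. -/
def invHomeomorph : Arr X ≃ₜ Arr X where
  toFun γ := arr (Groupoid.inv γ.hom)
  invFun γ := arr (Groupoid.inv γ.hom)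
  left_inv γ := by simp
  right_inv γ := by simp
  continuous_toFun := hX.continuous_inv
  continuous_invFun := hX.continuous_inv

theorem isLocalHomeomorph_dom : IsLocalHomeomorph (Arr.dom : Arr X → X) :=
  hX.isLocalHomeomorph_cod.comp invHomeomorph.isLocalHomeomorph

theorem IsCompactOpenBisection.setInv {U : Set (Arr X)} (hU : IsCompactOpenBisection U) :
    IsCompactOpenBisection (setInv U) where
  isBisection :=
    ⟨fun _ hγ _ hδ h => invHomeomorph.injective (hU.isBisection.2 hγ hδ h),
      fun _ hγ _ hδ h => invHomeomorph.injective (hU.isBisection.1 hγ hδ h)⟩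
  isCompact := invHomeomorph.isCompact_preimage.2 hU.isCompact
  isOpen := hU.isOpen.preimage hX.continuous_inv

/-- A continuous section of the range map is an open embedding, because the range map is a local
homeomorphism. -/
theorem isCompactOpenBisection_range {V : CompactOpens X} {t : V → Arr X} (ht : Continuous t)
    (hcod : ∀ x, (t x).cod = x) (hdom : Function.Injective fun x => (t x).dom) :
    IsCompactOpenBisection (Set.range t) where
  isBisection := by
    constructor
    · rintro _ ⟨x, rfl⟩ _ ⟨y, rfl⟩ h
      rw [hdom h]
    · rintro _ ⟨x, rfl⟩ _ ⟨y, rfl⟩ h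
      rw [Subtype.ext ((hcod x).symm.trans (h.trans (hcod y)))]
  isCompact :=
    have := isCompact_iff_compactSpace.1 V.isCompact
    isCompact_range ht
  isOpen := by
    have hval : Arr.cod ∘ t = Subtype.val := funext hcod
    exact (hX.isLocalHomeomorph_cod.isOpenEmbedding_of_comp
      (hval ▸ V.isOpen.isOpenEmbedding_subtypeVal) ht).isOpen_range

theorem isCompactOpenBisection_unitSet (V : CompactOpens X) :
    IsCompactOpenBisection (unitSet (V : Set X)) := by
  rw [unitSet, Set.image_eq_range]
  exact isCompactOpenBisection_range (hX.continuous_id.comp continuous_subtype_val)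
    (fun _ => rfl) Subtype.val_injective

theorem exists_compactOpens {x : X} {S : Set X} (hS : S ∈ 𝓝 x) :
    ∃ V : CompactOpens X, x ∈ V ∧ (V : Set X) ⊆ S := by
  obtain ⟨V, ⟨hVc, hVo⟩, hx, hVS⟩ := hX.isTopologicalBasis.mem_nhds_iff.1 hS
  exact ⟨⟨⟨V, hVc⟩, hVo⟩, hx, hVS⟩

theorem exists_compactOpenBisection {γ : Arr X} {S : Set (Arr X)} (hS : S ∈ 𝓝 γ) :
    ∃ U, IsCompactOpenBisection U ∧ γ ∈ U ∧ U ⊆ S := by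
  obtain ⟨N, hNo, hγN, hinj⟩ := isLocalHomeomorph_dom.isLocallyInjective γ
  obtain ⟨_, ⟨W, hW, s, hcod, rfl⟩, ⟨y, rfl⟩, hsS⟩ :=
    hX.isLocalHomeomorph_cod.isTopologicalBasis.mem_nhds_iff.1
      (Filter.inter_mem hS (hNo.mem_nhds hγN))
  obtain ⟨V, hyV, hVW⟩ := exists_compactOpens (hW.mem_nhds y.2)
  have hs : ∀ x : V, s (Set.inclusion hVW x) ∈ S ∩ N := fun x => hsS ⟨_, rfl⟩
  refine ⟨Set.range (s ∘ Set.inclusion hVW), isCompactOpenBisection_range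
    (s.continuous.comp (continuous_inclusion hVW)) (fun x => congrFun hcod _) ?_,
    ⟨⟨y, hyV⟩, rfl⟩, ?_⟩
  · intro x x' h
    have h' := hinj (hs x).2 (hs x').2 h
    have hcod' := congrArg Arr.cod h'
    exact Subtype.ext (((congrFun hcod _).symm.trans hcod').trans (congrFun hcod _))
  · rintro _ ⟨x, rfl⟩
    exact (hs x).1

theorem IsCompactOpenBisection.exists_compactOpens_forall_dom_mem {U : Set (Arr X)}
    (hU : IsCompactOpenBisection U) {W : Set X} (hW : IsOpen W) {y : X}
    (h : ∀ γ ∈ U, γ.cod = y → γ.dom ∈ W) :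
    ∃ V : CompactOpens X, y ∈ V ∧ ∀ γ ∈ U, γ.cod ∈ V → γ.dom ∈ W := by
  have : T2Space X := hX.t2Space
  have hK : IsClosed (Arr.cod '' (U \ Arr.dom ⁻¹' W)) :=
    ((hU.isCompact.diff (hW.preimage hX.continuous_dom)).image hX.continuous_cod).isClosed
  have hyK : y ∉ Arr.cod '' (U \ Arr.dom ⁻¹' W) := by
    rintro ⟨γ, ⟨hγ, hγW⟩, hγy⟩
    exact hγW (h γ hγ hγy)
  obtain ⟨V, hyV, hV⟩ := exists_compactOpens (hK.isOpen_compl.mem_nhds hyK)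
  refine ⟨V, hyV, fun γ hγ hγV => ?_⟩
  by_contra hγW
  exact hV hγV ⟨γ, ⟨hγ, hγW⟩, rfl⟩

end ArrowSpace

section Convolution

variable {X : Type u} [Groupoid.{v} X] [TopologicalSpace X] [TopologicalSpace (Arr X)]
  {O : SheafOfRings.{u, v, w} X}

theorem conv_mul_of_mem_right (f : Fn O) {b : Fn O} {C : Set (Arr X)} (hC : Set.InjOn Arr.dom C)
    (hb : ∀ γ, γ ∉ C → b γ = 0) {x y z : X} (ρ : x ⟶ y) (β : y ⟶ z) (hρ : arr ρ ∈ C) :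
    conv f b (arr (ρ ≫ β)) = f (arr β) * O.act β (b (arr ρ)) := by
  rw [conv_apply, finsum_eq_single _ (⟨y, β⟩ : Σ y : X, (y ⟶ z))]
  · rw [show (ρ ≫ β) ≫ Groupoid.inv β = ρ by simp]
  · rintro ⟨y', β'⟩ hne
    rw [hb, map_zero, mul_zero]
    intro hmem
    have hρ' : arr ((ρ ≫ β) ≫ Groupoid.inv β') = arr ρ := hC hmem hρ rfl
    obtain rfl : y' = y := congrArg Arr.cod hρ'
    have hβ : (ρ ≫ β) ≫ Groupoid.inv β' = ρ := by simpa using hρ'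
    rw [Groupoid.inv_eq_inv, IsIso.comp_inv_eq, cancel_epi] at hβ
    exact hne (by rw [hβ])

theorem diag_conv {a : Fn O} (ha : ∀ γ, γ ∉ units X → a γ = 0) (f : Fn O) (γ : Arr X) :
    conv a f γ = a (arr (𝟙 γ.cod)) * f γ := by
  have h : conv a f (arr (γ.hom ≫ 𝟙 γ.cod)) = _ :=
    conv_mul_of_mem isBisection_units.2 ha ⟨γ.hom, 𝟙 γ.cod⟩ ⟨γ.cod, rfl⟩
  rwa [O.act_id, Category.comp_id] at h

theorem conv_diag {a : Fn O} (ha : ∀ γ, γ ∉ units X → a γ = 0) (f : Fn O) (γ : Arr X) :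
    conv f a γ = f γ * O.act γ.hom (a (arr (𝟙 γ.dom))) := by
  have h := conv_mul_of_mem_right f isBisection_units.1 ha (𝟙 γ.dom) γ.hom ⟨γ.dom, rfl⟩
  rwa [Category.id_comp] at h

theorem eq_zero_of_mem_gammaOn {H : Set (Arr X)} {f : Fn O} (hf : f ∈ gammaOn O H) :
    ∀ γ, γ ∉ H → f γ = 0 := by
  induction hf using AddSubgroup.closure_induction with
  | mem f h =>
    obtain ⟨U, -, hUH, -, h0⟩ := h
    exact fun γ hγ => h0 γ fun h => hγ (hUH h)
  | zero => exact fun _ _ => rfl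
  | add f g _ _ hf hg => exact fun γ hγ => by simp [hf γ hγ, hg γ hγ]
  | neg f _ hf => exact fun γ hγ => by simp [hf γ hγ]

theorem SupportedOn.mem_gammaOn {f : Fn O} {U H : Set (Arr X)} (hf : SupportedOn f U)
    (hU : IsCompactOpenBisection U) (hUH : U ⊆ H) : f ∈ gammaOn O H :=
  AddSubgroup.subset_closure ⟨U, hU, hUH, hf⟩

theorem SupportedOn.continuousAt {f : Fn O} {U : Set (Arr X)} (hf : SupportedOn f U)
    (hU : IsOpen U) {γ : Arr X} (hγ : γ ∈ U) : ContinuousAt f.toTot γ :=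
  hf.1.continuousAt (hU.mem_nhds hγ)

theorem SupportedOn.neg {f : Fn O} {U : Set (Arr X)} (hf : SupportedOn f U) (hU : IsOpen U) :
    SupportedOn (-f) U :=
  ⟨fun _ hγ => (continuousAt_neg (hf.continuousAt hU hγ)).continuousWithinAt,
    fun γ hγ => by simp [hf.2 γ hγ]⟩

theorem SupportedOn.sub {f g : Fn O} {U : Set (Arr X)} (hf : SupportedOn f U)
    (hg : SupportedOn g U) (hU : IsOpen U) : SupportedOn (f - g) U := by
  rw [sub_eq_add_neg]
  exact ⟨fun _ hγ => (continuousAt_add (hf.continuousAt hU hγ)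
    ((hg.neg hU).continuousAt hU hγ)).continuousWithinAt,
    fun γ hγ => by simp [hf.2 γ hγ, hg.2 γ hγ]⟩

open Classical in
/-- The function that on `U` is the pullback along the range map of the section `s` of the stalks,
extended by zero. -/
noncomputable def sectionOn (U : Set (Arr X)) (s : ∀ x, O.stalk x) : Fn O :=
  fun γ => if γ ∈ U then s γ.cod else 0

theorem sectionOn_of_mem {U : Set (Arr X)} (s : ∀ x, O.stalk x) {γ : Arr X} (h : γ ∈ U) :
    sectionOn U s γ = s γ.cod := if_pos h

theorem sectionOn_of_notMem {U : Set (Arr X)} (s : ∀ x, O.stalk x) {γ : Arr X} (h : γ ∉ U) :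
    sectionOn U s γ = 0 := if_neg h

variable [hX : IsAmple X]

theorem supportedOn_sectionOn {U : Set (Arr X)} {s : ∀ x, O.stalk x}
    (hs : ∀ γ ∈ U, ContinuousAt (fun x => (⟨x, s x⟩ : Tot O.stalk)) γ.cod) :
    SupportedOn (sectionOn U s) U := by
  refine ⟨fun γ hγ => ?_, fun γ => sectionOn_of_notMem s⟩
  have h : ContinuousAt (fun γ : Arr X => (⟨γ.cod, s γ.cod⟩ : Tot O.stalk)) γ :=
    (hs γ hγ).comp (f := Arr.cod) hX.continuous_cod.continuousAt
  refine h.continuousWithinAt.congr (fun δ hδ => ?_) ?_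
  · rw [Fn.toTot, sectionOn_of_mem s hδ]
  · rw [Fn.toTot, sectionOn_of_mem s hγ]

theorem exists_supportedOn_apply_eq (γ : Arr X) (v : O.stalk γ.cod) :
    ∃ (U : Set (Arr X)) (f : Fn O),
      IsCompactOpenBisection U ∧ γ ∈ U ∧ SupportedOn f U ∧ f γ = v := by
  obtain ⟨s, hsγ, hs⟩ := exists_section (O := O) γ.cod v
  obtain ⟨U, hU, hγU, hUs⟩ :=
    exists_compactOpenBisection (hX.continuous_cod.continuousAt.eventually hs)
  exact ⟨U, sectionOn U s, hU, hγU, supportedOn_sectionOn fun δ hδ => hUs hδ,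
    (sectionOn_of_mem s hγU).trans hsγ⟩

theorem continuous_diag {a : Fn O} (ha : a ∈ gammaOn O (units X)) :
    Continuous fun x : X => (⟨x, a (arr (𝟙 x))⟩ : Tot O.stalk) := by
  refine continuous_iff_continuousAt.2 fun x => ?_
  induction ha using AddSubgroup.closure_induction with
  | mem f h =>
    obtain ⟨U, hU, hUH, hf⟩ := h
    by_cases hx : arr (𝟙 x) ∈ U
    · exact (hf.continuousAt hU.isOpen hx).comp (f := fun x : X => arr (𝟙 x))
        hX.continuous_id.continuousAt
    · have : T2Space X := hX.t2Space
      have hclosed : IsClosed (Arr.cod '' U) := (hU.isCompact.image hX.continuous_cod).isClosed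
      have hxU : x ∉ Arr.cod '' U := by
        rintro ⟨γ, hγ, rfl⟩
        obtain ⟨y, rfl⟩ := hUH hγ
        exact hx hγ
      refine continuous_zero_section.continuousAt.congr ?_
      filter_upwards [hclosed.isOpen_compl.mem_nhds hxU] with y hy
      rw [hf.2 _ fun h => hy ⟨_, h, rfl⟩]
  | zero => exact continuous_zero_section.continuousAt
  | add f g _ _ hf hg => exact continuousAt_add hf hg
  | neg f _ hf => exact continuousAt_neg hf

theorem SupportedOn.diag_conv {a f : Fn O} {U : Set (Arr X)} (ha : a ∈ gammaOn O (units X))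
    (hf : SupportedOn f U) (hU : IsOpen U) : SupportedOn (conv a f) U := by
  have hconv := GroupoidAlg.diag_conv (eq_zero_of_mem_gammaOn ha) f
  refine ⟨fun γ hγ => ContinuousAt.continuousWithinAt ?_, fun γ hγ => ?_⟩
  · unfold Fn.toTot
    simp only [hconv]
    exact continuousAt_mul ((continuous_diag ha).comp hX.continuous_cod).continuousAt
      (hf.continuousAt hU hγ)
  · rw [hconv, hf.2 γ hγ, mul_zero]

theorem SupportedOn.conv_diag {a f : Fn O} {U : Set (Arr X)} (ha : a ∈ gammaOn O (units X))
    (hf : SupportedOn f U) (hU : IsOpen U) : SupportedOn (conv f a) U := by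
  have hconv := GroupoidAlg.conv_diag (eq_zero_of_mem_gammaOn ha) f
  refine ⟨fun γ hγ => ContinuousAt.continuousWithinAt ?_, fun γ hγ => ?_⟩
  · unfold Fn.toTot
    simp only [hconv]
    exact continuousAt_mul (hf.continuousAt hU hγ)
      (continuousAt_act continuousAt_id
        ((continuous_diag ha).comp hX.continuous_dom).continuousAt)
  · rw [hconv, hf.2 γ hγ, zero_mul]

end Convolution

section Gamma

open TopologicalSpace (CompactOpens)

variable {X : Type u} [Groupoid.{v} X] [TopologicalSpace X] [TopologicalSpace (Arr X)]
  {O : SheafOfRings.{u, v, w} X}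

/-- An element of `Γ_c(𝒢, 𝒪)` that is supported on a single compact open bisection. These elements
generate `Γ_c(𝒢, 𝒪)` additively. -/
def IsBisectionSupported (f : Gamma O) : Prop :=
  ∃ U, IsCompactOpenBisection U ∧ SupportedOn f.1 U

theorem IsBisectionSupported.neg {f : Gamma O} (hf : IsBisectionSupported f) :
    IsBisectionSupported (-f) :=
  let ⟨U, hU, hfU⟩ := hf
  ⟨U, hU, hfU.neg hU.isOpen⟩

theorem Gamma.exists_apply_ne_zero {f : Gamma O} (hf : f ≠ 0) : ∃ γ, f.1 γ ≠ 0 := by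
  by_contra! h
  exact hf (Subtype.ext (funext h))

@[elab_as_elim]
theorem Gamma.induction {p : Gamma O → Prop} (supported : ∀ f, IsBisectionSupported f → p f)
    (zero : p 0) (add : ∀ f g, p f → p g → p (f + g)) (f : Gamma O) : p f := by
  suffices h : p f ∧ p (-f) from h.1
  have hf : f ∈ AddSubgroup.closure {f : Gamma O | ∃ U, IsCompactOpenBisection U ∧
      U ⊆ Set.univ ∧ SupportedOn f.1 U} :=
    AddSubgroup.closure_closure_coe_preimage.ge (AddSubgroup.mem_top f)
  induction hf using AddSubgroup.closure_induction with
  | mem f h =>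
    obtain ⟨U, hU, -, hfU⟩ := h
    have hf : IsBisectionSupported f := ⟨U, hU, hfU⟩
    exact ⟨supported f hf, supported (-f) hf.neg⟩
  | zero => simpa using zero
  | add f g _ _ hf hg => exact ⟨add f g hf.1 hg.1, neg_add f g ▸ add _ _ hf.2 hg.2⟩
  | neg f _ hf => exact ⟨hf.2, (neg_neg f).symm ▸ hf.1⟩

theorem Gamma.exists_multiset_sum_eq (f : Gamma O) :
    ∃ s : Multiset (Gamma O), (∀ g ∈ s, IsBisectionSupported g) ∧ s.sum = f := by
  induction f using Gamma.induction with
  | supported f hf => exact ⟨{f}, by simpa using hf, by simp⟩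
  | zero => exact ⟨0, by simp, by simp⟩
  | add f g hf hg =>
    obtain ⟨⟨s, hs, rfl⟩, t, ht, rfl⟩ := hf, hg
    exact ⟨s + t, fun g hg => (Multiset.mem_add.1 hg).elim (hs g) (ht g), Multiset.sum_add s t⟩

variable [hX : IsAmple X]

theorem IsBisectionSupported.mul {f g : Gamma O} (hf : IsBisectionSupported f)
    (hg : IsBisectionSupported g) : IsBisectionSupported (f * g) :=
  let ⟨U, hU, hfU⟩ := hf
  let ⟨V, hV, hgV⟩ := hg
  ⟨setMul U V, isCompactOpenBisection_setMul hU hV, supportedOn_conv hU hV hfU hgV⟩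

theorem IsBisectionSupported.mul_sub_mul {a f : Gamma O} (ha : a ∈ diagonal O)
    (hf : IsBisectionSupported f) : IsBisectionSupported (a * f - f * a) :=
  let ⟨U, hU, hfU⟩ := hf
  ⟨U, hU, (hfU.diag_conv ha hU.isOpen).sub (hfU.conv_diag ha hU.isOpen) hU.isOpen⟩

theorem exists_apply_id_ne_zero_of_mem_diagonal {a : Gamma O} (ha : a ∈ diagonal O) (ha0 : a ≠ 0) :
    ∃ x : X, a.1 (arr (𝟙 x)) ≠ 0 := by
  obtain ⟨γ, hγ⟩ := Gamma.exists_apply_ne_zero ha0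
  obtain ⟨x, rfl⟩ : γ ∈ units X := by_contra fun h => hγ (eq_zero_of_mem_gammaOn ha γ h)
  exact ⟨x, hγ⟩

theorem eq_of_mem_diagonal {a b : Gamma O} (ha : a ∈ diagonal O) (hb : b ∈ diagonal O)
    (h : ∀ x : X, a.1 (arr (𝟙 x)) = b.1 (arr (𝟙 x))) : a = b := by
  by_contra hne
  obtain ⟨x, hx⟩ := exists_apply_id_ne_zero_of_mem_diagonal (sub_mem ha hb) (sub_ne_zero.2 hne)
  exact hx (sub_eq_zero.2 (h x))

/-- The function with value `1` on a compact open bisection and `0` elsewhere. -/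
noncomputable def indicator {U : Set (Arr X)} (hU : IsCompactOpenBisection U) : Gamma O :=
  ⟨sectionOn U fun _ => 1, (supportedOn_sectionOn fun _ _ =>
    O.continuous_one.continuousAt).mem_gammaOn hU (Set.subset_univ U)⟩

theorem supportedOn_indicator {U : Set (Arr X)} (hU : IsCompactOpenBisection U) :
    SupportedOn (indicator hU : Gamma O).1 U :=
  supportedOn_sectionOn fun _ _ => O.continuous_one.continuousAt

theorem indicator_apply_of_mem {U : Set (Arr X)} (hU : IsCompactOpenBisection U) {γ : Arr X}
    (hγ : γ ∈ U) : (indicator hU : Gamma O).1 γ = 1 := if_pos hγ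

theorem mul_indicator_setInv_apply_id (f : Gamma O) {U : Set (Arr X)}
    (hU : IsCompactOpenBisection U) {γ : Arr X} (hγ : γ ∈ U) :
    (f * indicator hU.setInv).1 (arr (𝟙 γ.cod)) = f.1 γ := by
  have hinv := arr_inv_mem_setInv.2 hγ
  have h := conv_mul_of_mem_right f.1 hU.setInv.isBisection.1
    (supportedOn_indicator (O := O) hU.setInv).2 (Groupoid.inv γ.hom) γ.hom hinv
  rw [indicator_apply_of_mem _ hinv, map_one, mul_one, Groupoid.inv_comp] at h
  exact h

theorem mul_indicator_setInv_mem_diagonal {f : Gamma O} {U : Set (Arr X)}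
    (hU : IsCompactOpenBisection U) (hf : SupportedOn f.1 U) :
    f * indicator hU.setInv ∈ diagonal O :=
  (supportedOn_conv hU hU.setInv hf (supportedOn_indicator hU.setInv)).mem_gammaOn
    (isCompactOpenBisection_setMul hU hU.setInv) hU.isBisection.setMul_setInv_subset_units

variable (O) in
/-- The idempotent of the diagonal given by a compact open set `V` of units. -/
noncomputable def unitIndicator (V : CompactOpens X) : Gamma O :=
  indicator (isCompactOpenBisection_unitSet V)

theorem unitIndicator_apply_of_notMem_units (V : CompactOpens X) {γ : Arr X}
    (hγ : γ ∉ units X) : (unitIndicator O V).1 γ = 0 :=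
  (supportedOn_indicator _).2 γ fun h => hγ (unitSet_subset_units _ h)

open Classical in
theorem unitIndicator_apply_id (V : CompactOpens X) (x : X) :
    (unitIndicator O V).1 (arr (𝟙 x)) = if x ∈ V then 1 else 0 :=
  if_congr arr_id_mem_unitSet rfl rfl

open Classical in
theorem unitIndicator_conv_apply (V : CompactOpens X) (f : Fn O) (γ : Arr X) :
    conv (unitIndicator O V).1 f γ = if γ.cod ∈ V then f γ else 0 := by
  rw [diag_conv fun _ => unitIndicator_apply_of_notMem_units V, unitIndicator_apply_id, ite_mul,
    one_mul, zero_mul]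

open Classical in
theorem conv_unitIndicator_apply (V : CompactOpens X) (f : Fn O) (γ : Arr X) :
    conv f (unitIndicator O V).1 γ = if γ.dom ∈ V then f γ else 0 := by
  rw [conv_diag fun _ => unitIndicator_apply_of_notMem_units V, unitIndicator_apply_id]
  split_ifs <;> simp

theorem unitIndicator_mem_diagonal (V : CompactOpens X) : unitIndicator O V ∈ diagonal O :=
  (supportedOn_indicator _).mem_gammaOn (isCompactOpenBisection_unitSet V)
    (unitSet_subset_units _)

theorem unitIndicator_mul_of_le {V W : CompactOpens X} (h : V ≤ W) :
    unitIndicator O V * unitIndicator O W = unitIndicator O V := by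
  refine eq_of_mem_diagonal (mul_mem (unitIndicator_mem_diagonal V) (unitIndicator_mem_diagonal W))
    (unitIndicator_mem_diagonal V) fun x => (unitIndicator_conv_apply V _ _).trans ?_
  rw [unitIndicator_apply_id, unitIndicator_apply_id]
  split_ifs with hV hW
  exacts [rfl, (hW (h hV)).elim, rfl]

theorem unitIndicator_mul_of_disjoint {V W : CompactOpens X}
    (h : Disjoint (V : Set X) (W : Set X)) : unitIndicator O V * unitIndicator O W = 0 := by
  refine eq_of_mem_diagonal (mul_mem (unitIndicator_mem_diagonal V) (unitIndicator_mem_diagonal W))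
    (zero_mem _) fun x => (unitIndicator_conv_apply V _ _).trans ?_
  rw [unitIndicator_apply_id]
  split_ifs with hV hW
  exacts [(h.notMem_of_mem_left hV hW).elim, rfl, rfl]

theorem unitIndicator_bot : unitIndicator O (⊥ : CompactOpens X) = 0 :=
  eq_of_mem_diagonal (unitIndicator_mem_diagonal ⊥) (zero_mem _) fun x =>
    (unitIndicator_apply_id ⊥ x).trans (if_neg id)

theorem unitIndicator_sup (V W : CompactOpens X) : unitIndicator O (V ⊔ W) =
    unitIndicator O V + unitIndicator O W - unitIndicator O V * unitIndicator O W := by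
  have hV := unitIndicator_mem_diagonal (O := O) V
  have hW := unitIndicator_mem_diagonal (O := O) W
  refine eq_of_mem_diagonal (unitIndicator_mem_diagonal (V ⊔ W))
    (sub_mem (add_mem hV hW) (mul_mem hV hW)) fun x => ?_
  change _ = (unitIndicator O V).1 _ + (unitIndicator O W).1 _ -
    conv (unitIndicator O V).1 (unitIndicator O W).1 _
  rw [unitIndicator_conv_apply, unitIndicator_apply_id, unitIndicator_apply_id,
    unitIndicator_apply_id]
  have hsup : x ∈ V ⊔ W ↔ x ∈ V ∨ x ∈ W := Iff.rfl
  by_cases hxV : x ∈ V <;> by_cases hxW : x ∈ W <;> simp [hsup, hxV, hxW]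

open Classical in
theorem unitIndicator_mul_mul_unitIndicator {f : Gamma O} {U : Set (Arr X)}
    (hf : SupportedOn f.1 U) {V W : CompactOpens X} (h : ∀ γ ∈ U, γ.cod ∈ V → γ.dom ∈ W) :
    unitIndicator O V * f * unitIndicator O W = unitIndicator O V * f := by
  refine Subtype.ext (funext fun γ => (conv_unitIndicator_apply W _ γ).trans ?_)
  refine ite_eq_left_iff.2 fun hγW => ((unitIndicator_conv_apply V _ γ).trans ?_).symm
  exact ite_eq_right_iff.2 fun hγV => hf.2 γ fun hγ => hγW (h γ hγ hγV)

open Classical in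
theorem IsBisectionSupported.exists_mul_unitIndicator_eq {f : Gamma O}
    (hf : IsBisectionSupported f) : ∃ W : CompactOpens X, f * unitIndicator O W = f := by
  obtain ⟨U, hU, hfU⟩ := hf
  refine ⟨⟨⟨Arr.dom '' U, hU.isCompact.image hX.continuous_dom⟩,
    isLocalHomeomorph_dom.isOpenMap U hU.isOpen⟩, Subtype.ext (funext fun γ => ?_)⟩
  refine (conv_unitIndicator_apply _ _ γ).trans (ite_eq_left_iff.2 fun hγ => (hfU.2 γ ?_).symm)
  exact fun hγU => hγ ⟨γ, hγU, rfl⟩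

theorem unitIndicator_ne_zero [∀ x, Nontrivial (O.stalk x)] {V : CompactOpens X} {x : X}
    (hx : x ∈ V) : unitIndicator O V ≠ 0 := by
  intro h
  have h1 := (unitIndicator_apply_id (O := O) V x).symm.trans (congrFun (congrArg Subtype.val h) _)
  rw [if_pos hx] at h1
  exact one_ne_zero h1

end Gamma

section Ideals

theorem IsMaximalCommutative.mem_of_commute {R : Type u} [NonUnitalRing R]
    {A : NonUnitalSubring R} (hA : IsMaximalCommutative A) {z : R}
    (hz : ∀ a ∈ A, a * z = z * a) : z ∈ A := by
  have hcomm : ∀ a ∈ insert z (A : Set R), ∀ b ∈ insert z (A : Set R), a * b = b * a := by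
    rintro a (rfl | ha) b (rfl | hb)
    · rfl
    · exact (hz b hb).symm
    · exact hz a ha
    · exact hA.prop a ha b hb
  have := NonUnitalSubring.isMulCommutative_closure hcomm
  refine hA.le_of_ge (y := NonUnitalSubring.closure (insert z (A : Set R)))
    (fun a ha b hb => setLike_mul_comm ha hb) ?_ (NonUnitalSubring.subset_closure (.inl rfl))
  exact fun a ha => NonUnitalSubring.subset_closure (.inr ha)

variable {X : Type u} [Groupoid.{v} X] [TopologicalSpace X] [TopologicalSpace (Arr X)]
  {O : SheafOfRings.{u, v, w} X}

theorem Gamma.exists_mem_apply_ne_zero_of_sum {s : Multiset (Gamma O)} {γ : Arr X}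
    (h : s.sum.1 γ ≠ 0) : ∃ f ∈ s, f.1 γ ≠ 0 := by
  induction s using Multiset.induction with
  | empty => exact absurd rfl h
  | cons f t ih =>
    by_cases hf : f.1 γ = 0
    · have ht : t.sum.1 γ ≠ 0 := by
        intro ht
        rw [Multiset.sum_cons] at h
        exact h ((congrArg₂ (· + ·) hf ht).trans (add_zero _))
      obtain ⟨g, hg, hgγ⟩ := ih ht
      exact ⟨g, Multiset.mem_cons_of_mem hg, hgγ⟩
    · exact ⟨f, Multiset.mem_cons_self f t, hf⟩

theorem sum_map_commutator {R : Type*} [NonUnitalRing R] (a b : R) (t : Multiset R) :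
    (t.map fun f => a * (f * b) - f * b * a).sum = a * (t.sum * b) - t.sum * b * a := by
  induction t using Multiset.induction with
  | empty => simp
  | cons f t ih =>
    rw [Multiset.map_cons, Multiset.sum_cons, ih, Multiset.sum_cons]
    noncomm_ring

variable [hX : IsAmple X]

theorem exists_mul_mem_diagonal {s : Multiset (Gamma O)}
    (hs : ∀ f ∈ s, IsBisectionSupported f) (h0 : s.sum ≠ 0) :
    ∃ f ∈ s, ∃ b, IsBisectionSupported b ∧ f * b ∈ diagonal O ∧ s.sum * b ≠ 0 := by
  obtain ⟨γ, hγ⟩ := Gamma.exists_apply_ne_zero h0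
  obtain ⟨f, hf, hfγ⟩ := Gamma.exists_mem_apply_ne_zero_of_sum hγ
  obtain ⟨U, hU, hfU⟩ := hs f hf
  have hγU : γ ∈ U := by_contra fun h => hfγ (hfU.2 γ h)
  refine ⟨f, hf, indicator hU.setInv, ⟨_, hU.setInv, supportedOn_indicator hU.setInv⟩,
    mul_indicator_setInv_mem_diagonal hU hfU, fun h => ?_⟩
  rw [← mul_indicator_setInv_apply_id _ hU hγU, h] at hγ
  exact hγ rfl

theorem exists_mem_diagonal_of_sum_mem (hmax : IsMaximalCommutative (diagonal O))
    (I : TwoSidedIdeal (Gamma O)) (s : Multiset (Gamma O)) (hs : ∀ f ∈ s, IsBisectionSupported f)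
    (hI : s.sum ∈ I) (h0 : s.sum ≠ 0) : ∃ a ∈ diagonal O, a ∈ I ∧ a ≠ 0 := by
  induction hn : s.card generalizing s with
  | zero => exact absurd (Multiset.card_eq_zero.1 hn ▸ Multiset.sum_zero) h0
  | succ n ih =>
    obtain ⟨f, hfs, b, hb, hfb, hsb⟩ := exists_mul_mem_diagonal hs h0
    have hsbI : s.sum * b ∈ I := I.mul_mem_right _ _ hI
    by_cases hd : s.sum * b ∈ diagonal O
    · exact ⟨_, hd, hsbI, hsb⟩
    obtain ⟨a, ha, hne⟩ : ∃ a ∈ diagonal O, a * (s.sum * b) ≠ s.sum * b * a := by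
      by_contra! h
      exact hd (hmax.mem_of_commute h)
    obtain ⟨t, rfl⟩ := Multiset.exists_cons_of_mem hfs
    -- `f * b` lies in the diagonal, so it does not contribute to the commutator with `a`.
    have hcomm : (t.map fun g => a * (g * b) - g * b * a).sum =
        a * ((f ::ₘ t).sum * b) - (f ::ₘ t).sum * b * a := by
      rw [← sum_map_commutator, Multiset.map_cons, Multiset.sum_cons, hmax.prop a ha _ hfb,
        sub_self, zero_add]
    refine ih (t.map fun g => a * (g * b) - g * b * a) ?_ ?_ ?_ (by simpa using hn)
    · refine Multiset.forall_mem_map_iff.2 fun g hg => ?_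
      exact ((hs g (Multiset.mem_cons_of_mem hg)).mul hb).mul_sub_mul ha
    · rw [hcomm]
      exact I.sub_mem (I.mul_mem_left _ _ hsbI) (I.mul_mem_right _ _ hsbI)
    · rw [hcomm]
      exact sub_ne_zero.2 hne

theorem exists_mem_diagonal_of_ne_bot (hmax : IsMaximalCommutative (diagonal O))
    {I : TwoSidedIdeal (Gamma O)} (hI : I ≠ ⊥) : ∃ a ∈ diagonal O, a ∈ I ∧ a ≠ 0 := by
  obtain ⟨f, hfI, hf0⟩ : ∃ f ∈ I, f ≠ 0 := by
    by_contra! h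
    exact hI (eq_bot_iff.2 fun f hf => h f hf)
  obtain ⟨s, hs, rfl⟩ := Gamma.exists_multiset_sum_eq f
  exact exists_mem_diagonal_of_sum_mem hmax I s hs hfI hf0

end Ideals

section EndomorphismAction

variable {R M : Type*} [NonUnitalRing R] [AddCommGroup M] (φ : R →ₙ+* AddMonoid.End M)

theorem map_mul_apply (r s : R) (m : M) : φ (r * s) m = φ r (φ s m) := by
  rw [map_mul]
  rfl

theorem map_add_apply (r s : R) (m : M) : φ (r + s) m = φ r m + φ s m := by
  rw [map_add]
  rfl

theorem map_zero_apply (m : M) : φ 0 m = 0 := by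
  rw [map_zero]
  rfl

end EndomorphismAction

section GermKernel

open TopologicalSpace (CompactOpens)

variable {X : Type u} [Groupoid.{v} X] [TopologicalSpace X] [TopologicalSpace (Arr X)]
  [hX : IsAmple X] {O : SheafOfRings.{u, v, w} X} {M : Type*} [AddCommGroup M]
  (φ : Gamma O →ₙ+* AddMonoid.End M)

theorem map_unitIndicator_eq_zero_of_le {V W : CompactOpens X} (h : V ≤ W) {m : M}
    (hm : φ (unitIndicator O W) m = 0) : φ (unitIndicator O V) m = 0 := by
  rw [← unitIndicator_mul_of_le h, map_mul_apply, hm, map_zero]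

theorem map_unitIndicator_sup_eq_zero {V W : CompactOpens X} {m : M}
    (hV : φ (unitIndicator O V) m = 0) (hW : φ (unitIndicator O W) m = 0) :
    φ (unitIndicator O (V ⊔ W)) m = 0 := by
  have h := map_add_apply φ (unitIndicator O (V ⊔ W)) (unitIndicator O V * unitIndicator O W) m
  rw [unitIndicator_sup, sub_add_cancel, ← unitIndicator_sup, map_add_apply, map_mul_apply, hV, hW,
    map_zero, add_zero, add_zero] at h
  exact h.symm

/-- The elements of the module `M` whose germ vanishes at every point of `S`, where `M` is regarded
as a sheaf on the unit space through the idempotents `unitIndicator O V`. -/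
def germKer (S : Set X) : AddSubgroup M where
  carrier := {m | ∀ y ∈ S, ∃ V : CompactOpens X, y ∈ V ∧ φ (unitIndicator O V) m = 0}
  zero_mem' y _ := by
    obtain ⟨V, hyV, -⟩ := exists_compactOpens (Filter.univ_mem (f := 𝓝 y))
    exact ⟨V, hyV, map_zero _⟩
  add_mem' hm hn y hy := by
    obtain ⟨⟨V, hyV, hV⟩, W, hyW, hW⟩ := hm y hy, hn y hy
    obtain ⟨V', hyV', hV'⟩ := exists_compactOpens
      ((V.isOpen.inter W.isOpen).mem_nhds ⟨hyV, hyW⟩)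
    refine ⟨V', hyV', ?_⟩
    rw [map_add, map_unitIndicator_eq_zero_of_le φ (fun _ h => (hV' h).1) hV,
      map_unitIndicator_eq_zero_of_le φ (fun _ h => (hV' h).2) hW, add_zero]
  neg_mem' hm y hy := by
    obtain ⟨V, hyV, hV⟩ := hm y hy
    exact ⟨V, hyV, by rw [map_neg, hV, neg_zero]⟩

variable {φ}

theorem map_mem_germKer {S : Set X} (hS : ∀ γ : Arr X, γ.cod ∈ S → γ.dom ∈ S) (f : Gamma O) {m : M}
    (hm : m ∈ germKer φ S) : φ f m ∈ germKer φ S := by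
  induction f using Gamma.induction with
  | supported f hf =>
    intro y hy
    obtain ⟨U, hU, hfU⟩ := hf
    obtain ⟨W, hmW, hUW⟩ : ∃ W : CompactOpens X, φ (unitIndicator O W) m = 0 ∧
        ∀ γ ∈ U, γ.cod = y → γ.dom ∈ W := by
      by_cases h : ∃ γ ∈ U, γ.cod = y
      · obtain ⟨γ, hγ, rfl⟩ := h
        obtain ⟨W, hγW, hmW⟩ := hm γ.dom (hS γ hy)
        exact ⟨W, hmW, fun δ hδ h => hU.isBisection.2 hδ hγ h ▸ hγW⟩
      · exact ⟨⊥, by rw [unitIndicator_bot, map_zero_apply], fun γ hγ hγy => (h ⟨γ, hγ, hγy⟩).elim⟩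
    obtain ⟨V, hyV, hV⟩ := hU.exists_compactOpens_forall_dom_mem W.isOpen hUW
    refine ⟨V, hyV, ?_⟩
    rw [← map_mul_apply, ← unitIndicator_mul_mul_unitIndicator hfU hV, map_mul_apply, hmW,
      map_zero]
  | zero => exact (map_zero_apply φ m).symm ▸ zero_mem _
  | add f g hf hg =>
    rw [map_add_apply]
    exact add_mem hf hg

theorem map_unitIndicator_eq_zero_of_mem_germKer_univ {m : M} (hm : m ∈ germKer φ Set.univ)
    (V : CompactOpens X) : φ (unitIndicator O V) m = 0 := by
  obtain ⟨W, hVW, hW⟩ : ∃ W : CompactOpens X, (V : Set X) ⊆ W ∧ φ (unitIndicator O W) m = 0 := by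
    refine V.isCompact.induction_on
      ⟨⊥, Set.empty_subset _, by rw [unitIndicator_bot, map_zero_apply]⟩ ?_ ?_ ?_
    · rintro s t hst ⟨W, htW, hW⟩
      exact ⟨W, hst.trans htW, hW⟩
    · rintro s t ⟨W, hsW, hW⟩ ⟨W', htW', hW'⟩
      exact ⟨W ⊔ W', Set.union_subset_union hsW htW', map_unitIndicator_sup_eq_zero φ hW hW'⟩
    · intro y _
      obtain ⟨W, hyW, hW⟩ := hm y trivial
      exact ⟨W, mem_nhdsWithin_of_mem_nhds (W.isOpen.mem_nhds hyW), W, subset_rfl, hW⟩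
  exact map_unitIndicator_eq_zero_of_le φ hVW hW

theorem map_eq_zero_of_mem_germKer_univ {m : M} (hm : m ∈ germKer φ Set.univ) (f : Gamma O) :
    φ f m = 0 := by
  induction f using Gamma.induction with
  | supported f hf =>
    obtain ⟨W, hW⟩ := hf.exists_mul_unitIndicator_eq
    rw [← hW, map_mul_apply, map_unitIndicator_eq_zero_of_mem_germKer_univ hm,
      map_zero]
  | zero => exact map_zero_apply φ m
  | add f g hf hg => rw [map_add_apply, hf, hg, add_zero]

theorem map_unitIndicator_mem_germKer {S : Set X} {V : CompactOpens X} (h : Disjoint (V : Set X) S)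
    (m : M) : φ (unitIndicator O V) m ∈ germKer φ S := by
  have : T2Space X := hX.t2Space
  intro y hy
  obtain ⟨W, hyW, hWV⟩ := exists_compactOpens
    (V.isCompact.isClosed.isOpen_compl.mem_nhds fun hyV => h.notMem_of_mem_left hyV hy)
  refine ⟨W, hyW, ?_⟩
  rw [← map_mul_apply, unitIndicator_mul_of_disjoint (Set.subset_compl_iff_disjoint_right.1 hWV),
    map_zero_apply]

theorem dense_orbit_of_germKer_eq_bot [∀ x, Nontrivial (O.stalk x)] (hφ : Function.Injective φ)
    {x : X} (h : germKer φ (orbit x) = ⊥) : Dense (orbit x) := by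
  refine dense_iff_inter_open.2 fun W hW ⟨y, hy⟩ => ?_
  obtain ⟨V, hyV, hVW⟩ := exists_compactOpens (hW.mem_nhds hy)
  by_contra hdisj
  have hV : Disjoint (V : Set X) (orbit x) :=
    (Set.disjoint_iff_inter_eq_empty.2 (Set.not_nonempty_iff_eq_empty.1 hdisj)).mono_left hVW
  refine unitIndicator_ne_zero (O := O) hyV (hφ (AddMonoidHom.ext fun m => ?_))
  have hm := map_unitIndicator_mem_germKer (φ := φ) hV m
  rw [h, AddSubgroup.mem_bot] at hm
  exact hm.trans (map_zero_apply φ m).symm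

theorem exists_dense_orbit_of_isLeftPrimitive [∀ x, Nontrivial (O.stalk x)]
    (h : IsLeftPrimitive (Gamma O)) : ∃ x : X, Dense (orbit x) := by
  obtain ⟨M, _, φ, hφ, ⟨f, m, hfm⟩, hsimple⟩ := h
  by_contra! hdense
  refine hfm (map_eq_zero_of_mem_germKer_univ (fun x _ => ?_) f)
  have htop : germKer φ (orbit x) = ⊤ :=
    (hsimple _ fun f m hm => map_mem_germKer (fun _ => dom_mem_orbit) f hm).resolve_left
      fun hbot => hdense x (dense_orbit_of_germKer_eq_bot hφ hbot)
  have hm : m ∈ germKer φ (orbit x) := htop ▸ AddSubgroup.mem_top m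
  exact hm x (mem_orbit.2 ⟨𝟙 x⟩)

end GermKernel

section OrbitModule

open TopologicalSpace (CompactOpens)

variable {X : Type u} [Groupoid.{v} X] [TopologicalSpace X] [TopologicalSpace (Arr X)]
  {O : SheafOfRings.{u, v, w} X}

open Classical in
/-- The element `v` of the stalk at `y`, encoded as the function on arrows with value `v` on
`r⁻¹(y)` and `0` elsewhere, so that convolution from the left becomes the action of `Γ_c(𝒢, 𝒪)` on
the stalks. -/
noncomputable def delta (y : X) : O.stalk y →+ Fn O where
  toFun v γ := Pi.single (M := O.stalk) y v γ.cod
  map_zero' := funext fun γ => congrFun (Pi.single_zero y) γ.cod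
  map_add' v w := funext fun γ => congrFun (Pi.single_add y v w) γ.cod

theorem delta_apply {x y : X} (v : O.stalk y) (γ : x ⟶ y) : delta y v (arr γ) = v := by
  classical
  exact Pi.single_eq_same (M := O.stalk) y v

theorem delta_apply_of_ne {y : X} (v : O.stalk y) {γ : Arr X} (h : γ.cod ≠ y) :
    delta y v γ = 0 := by
  classical
  exact Pi.single_eq_of_ne (M := O.stalk) h v

theorem delta_ne_zero {y : X} {v : O.stalk y} (hv : v ≠ 0) : (delta y v : Fn O) ≠ 0 := fun h =>
  hv ((delta_apply v (𝟙 y)).symm.trans (congrFun h _))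

theorem conv_delta_apply_eq_zero {f : Fn O} {y : X} (v : O.stalk y) {ρ : Arr X}
    (h : ∀ b : y ⟶ ρ.cod, f (arr b) = 0) : conv f (delta y v) ρ = 0 := by
  refine (conv_apply f _ ρ.hom).trans (finsum_eq_zero_of_forall_eq_zero fun ⟨y', b⟩ => ?_)
  by_cases hy : y' = y
  · subst hy
    rw [h b, zero_mul]
  · rw [delta_apply_of_ne v hy, map_zero, mul_zero]

theorem conv_delta {f : Fn O} {U : Set (Arr X)} (hU : IsBisection U) (hf : ∀ γ, γ ∉ U → f γ = 0)
    {y z : X} {γ : y ⟶ z} (hγ : arr γ ∈ U) (v : O.stalk y) :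
    conv f (delta y v) = delta z (f (arr γ) * O.act γ v) := by
  funext ⟨x, z', ρ⟩
  by_cases hz : z' = z
  · subst hz
    have h : conv f (delta y v) (arr ((ρ ≫ Groupoid.inv γ) ≫ γ)) = _ :=
      conv_mul_of_mem hU.2 hf ⟨ρ ≫ Groupoid.inv γ, γ⟩ hγ
    rw [delta_apply, Category.assoc, Groupoid.inv_comp, Category.comp_id] at h
    rw [h, delta_apply]
  · rw [delta_apply_of_ne _ hz, conv_delta_apply_eq_zero]
    exact fun b => hf _ fun hb => hz (congrArg Arr.cod (hU.1 hb hγ rfl))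

variable (O) in
/-- The simple module attached to the orbit of `x`: the direct sum of the stalks along the orbit,
realised inside `Fn O`. -/
def orbitModule (x : X) : AddSubgroup (Fn O) :=
  AddSubgroup.closure {m | ∃ y ∈ orbit x, ∃ v, delta y v = m}

theorem delta_mem_orbitModule {x y : X} (hy : y ∈ orbit x) (v : O.stalk y) :
    delta y v ∈ orbitModule O x :=
  AddSubgroup.subset_closure ⟨y, hy, v, rfl⟩

theorem apply_eq_zero_of_mem_orbitModule {x : X} {m : Fn O} (hm : m ∈ orbitModule O x) {γ : Arr X}
    (hγ : γ.cod ∉ orbit x) : m γ = 0 := by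
  induction hm using AddSubgroup.closure_induction with
  | mem m h =>
    obtain ⟨y, hy, v, rfl⟩ := h
    exact delta_apply_of_ne v fun h => hγ (h ▸ hy)
  | zero => rfl
  | add m n _ _ hm hn => rw [Pi.add_apply, hm, hn, add_zero]
  | neg m _ hm => rw [Pi.neg_apply, hm, neg_zero]

theorem conv_mem_orbitModule (f : Gamma O) {x : X} {m : Fn O} (hm : m ∈ orbitModule O x) :
    conv f.1 m ∈ orbitModule O x := by
  induction hm using AddSubgroup.closure_induction with
  | mem m h =>
    obtain ⟨y, hy, v, rfl⟩ := h
    induction f using Gamma.induction with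
    | supported f hf =>
      obtain ⟨U, hU, hfU⟩ := hf
      by_cases h : ∃ γ ∈ U, γ.dom = y
      · obtain ⟨γ, hγ, rfl⟩ := h
        obtain ⟨ρ⟩ := mem_orbit.1 hy
        rw [conv_delta hU.isBisection hfU.2 hγ]
        exact delta_mem_orbitModule (mem_orbit.2 ⟨ρ ≫ γ.hom⟩) _
      · have h0 : conv f.1 (delta y v) = 0 := funext fun ρ =>
          conv_delta_apply_eq_zero v fun b => hfU.2 _ fun hb => h ⟨_, hb, rfl⟩
        exact h0 ▸ zero_mem _
    | zero => exact (zero_conv (delta y v)).symm ▸ zero_mem _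
    | add f g hf hg =>
      exact (add_conv (finFib_of_mem f.2) (finFib_of_mem g.2) (delta y v)).symm ▸ add_mem hf hg
  | zero => exact (conv_zero f.1).symm ▸ zero_mem _
  | add m n _ _ hm hn => exact (conv_add (finFib_of_mem f.2) m n).symm ▸ add_mem hm hn
  | neg m _ hm => exact (conv_neg f.1 m).symm ▸ neg_mem hm

variable [hX : IsAmple X]

variable (O) in
/-- The action of `Γ_c(𝒢, 𝒪)` on the module of an orbit. -/
noncomputable def orbitAction (x : X) : Gamma O →ₙ+* AddMonoid.End (orbitModule O x) where
  toFun f :=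
    { toFun := fun m => ⟨conv f.1 m.1, conv_mem_orbitModule f m.2⟩
      map_zero' := Subtype.ext (conv_zero f.1)
      map_add' := fun m n => Subtype.ext (conv_add (finFib_of_mem f.2) m.1 n.1) }
  map_mul' f g := AddMonoidHom.ext fun _ =>
    Subtype.ext (conv_assoc (finFib_of_mem f.2) (finFib_of_mem g.2))
  map_zero' := AddMonoidHom.ext fun m => Subtype.ext (zero_conv m.1)
  map_add' f g := AddMonoidHom.ext fun m =>
    Subtype.ext (add_conv (finFib_of_mem f.2) (finFib_of_mem g.2) m.1)

theorem coe_orbitAction_apply {x : X} (f : Gamma O) (m : orbitModule O x) :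
    (orbitAction O x f m : Fn O) = conv f.1 m := rfl

open Classical in
theorem unitIndicator_conv_delta (V : CompactOpens X) {y : X} (v : O.stalk y) :
    conv (unitIndicator O V).1 (delta y v) = if y ∈ V then delta y v else 0 := by
  funext γ
  rw [unitIndicator_conv_apply]
  by_cases hγ : γ.cod = y
  · subst hγ
    split_ifs <;> rfl
  · rw [delta_apply_of_ne v hγ]
    split_ifs
    exacts [(delta_apply_of_ne v hγ).symm, rfl, (delta_apply_of_ne v hγ).symm, rfl]

theorem exists_unitIndicator_conv_eq_delta {x : X} {m : Fn O} (hm : m ∈ orbitModule O x) (y : X) :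
    ∃ (v : O.stalk y) (V : CompactOpens X), y ∈ V ∧
      ∀ W ≤ V, y ∈ W → conv (unitIndicator O W).1 m = delta y v := by
  classical
  have : T2Space X := hX.t2Space
  induction hm using AddSubgroup.closure_induction with
  | mem m h =>
    obtain ⟨z, -, v, rfl⟩ := h
    by_cases hyz : y = z
    · subst hyz
      obtain ⟨V, hyV, -⟩ := exists_compactOpens (Filter.univ_mem (f := 𝓝 y))
      exact ⟨v, V, hyV, fun W _ hy => (unitIndicator_conv_delta W v).trans (if_pos hy)⟩
    · obtain ⟨V, hyV, hV⟩ := exists_compactOpens (isOpen_ne.mem_nhds hyz)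
      exact ⟨0, V, hyV, fun W hW _ => by
        rw [unitIndicator_conv_delta, if_neg fun hz => hV (hW hz) rfl, map_zero]⟩
  | zero =>
    obtain ⟨V, hyV, -⟩ := exists_compactOpens (Filter.univ_mem (f := 𝓝 y))
    exact ⟨0, V, hyV, fun W _ _ => by rw [conv_zero, map_zero]⟩
  | add m n _ _ hm hn =>
    obtain ⟨⟨v, V, hyV, hV⟩, w, W, hyW, hW⟩ := hm, hn
    obtain ⟨V', hyV', hV'⟩ := exists_compactOpens ((V.isOpen.inter W.isOpen).mem_nhds ⟨hyV, hyW⟩)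
    refine ⟨v + w, V', hyV', fun W' hW' hy => ?_⟩
    rw [conv_add (finFib_of_mem (unitIndicator O W').2), map_add,
      hV W' (fun _ h => (hV' (hW' h)).1) hy, hW W' (fun _ h => (hV' (hW' h)).2) hy]
  | neg m _ hm =>
    obtain ⟨v, V, hyV, hV⟩ := hm
    exact ⟨-v, V, hyV, fun W hW hy => by rw [conv_neg, hV W hW hy, map_neg]⟩

theorem exists_orbitAction_eq_delta_of_ne_zero {x : X} {m : orbitModule O x} (hm : m ≠ 0) :
    ∃ y ∈ orbit x, ∃ v : O.stalk y, v ≠ 0 ∧ ∃ f, (orbitAction O x f m : Fn O) = delta y v := by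
  classical
  obtain ⟨γ, hγ⟩ : ∃ γ, (m : Fn O) γ ≠ 0 := by
    by_contra! h
    exact hm (Subtype.ext (funext h))
  obtain ⟨v, V, hyV, hV⟩ := exists_unitIndicator_conv_eq_delta m.2 γ.cod
  refine ⟨γ.cod, by_contra fun h => hγ (apply_eq_zero_of_mem_orbitModule m.2 h), v, ?_,
    unitIndicator O V, hV V le_rfl hyV⟩
  rintro rfl
  have h := congrFun (hV V le_rfl hyV) γ
  rw [unitIndicator_conv_apply, if_pos hyV, map_zero] at h
  exact hγ h

theorem exists_orbitAction_eq_delta (hO : O.IsSheafOfFields) {x : X} {m : orbitModule O x}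
    (hm : m ≠ 0) {z : X} (hz : z ∈ orbit x) (v : O.stalk z) :
    ∃ f, (orbitAction O x f m : Fn O) = delta z v := by
  obtain ⟨y, hy, u, hu, f, hf⟩ := exists_orbitAction_eq_delta_of_ne_zero hm
  obtain ⟨⟨ρ⟩, ⟨ρ'⟩⟩ := mem_orbit.1 hy, mem_orbit.1 hz
  let γ : y ⟶ z := Groupoid.inv ρ ≫ ρ'
  obtain ⟨u', huu'⟩ := (hO y).mul_inv_cancel hu
  obtain ⟨U, g, hU, hγU, hgU, hgγ⟩ :=
    exists_supportedOn_apply_eq (O := O) (arr γ) (v * O.act γ u')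
  let g' : Gamma O := ⟨g, hgU.mem_gammaOn hU (Set.subset_univ U)⟩
  refine ⟨g' * f, ?_⟩
  rw [map_mul_apply, coe_orbitAction_apply, hf, conv_delta hU.isBisection hgU.2 hγU, hgγ, mul_assoc,
    ← map_mul, (hO y).mul_comm, huu', map_one, mul_one]

theorem eq_bot_or_eq_top_of_orbitAction_mem (hO : O.IsSheafOfFields) {x : X}
    (N : AddSubgroup (orbitModule O x)) (hN : ∀ f, ∀ m ∈ N, orbitAction O x f m ∈ N) :
    N = ⊥ ∨ N = ⊤ := by
  refine N.bot_or_exists_ne_zero.imp_right fun ⟨m, hmN, hm⟩ => ?_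
  have hle : orbitModule O x ≤ N.map (orbitModule O x).subtype := by
    refine (AddSubgroup.closure_le _).2 ?_
    rintro _ ⟨y, hy, v, rfl⟩
    obtain ⟨f, hf⟩ := exists_orbitAction_eq_delta hO hm hy v
    exact ⟨_, hN f m hmN, hf⟩
  refine (AddSubgroup.eq_top_iff' N).2 fun n => ?_
  obtain ⟨n', hn', hn⟩ := hle n.2
  exact Subtype.ext hn ▸ hn'

theorem orbitAction_injective (hO : O.IsSheafOfFields) (hmax : IsMaximalCommutative (diagonal O))
    {x : X} (hx : Dense (orbit x)) : Function.Injective (orbitAction O x) := by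
  rw [← TwoSidedIdeal.ker_eq_bot]
  by_contra hker
  obtain ⟨a, had, haker, ha0⟩ := exists_mem_diagonal_of_ne_bot hmax hker
  obtain ⟨y, hy⟩ := exists_apply_id_ne_zero_of_mem_diagonal had ha0
  obtain ⟨S, hS, hSo, hyS⟩ := mem_nhds_iff.1
    (eventually_ne_zero hO (continuous_diag had).continuousAt hy)
  obtain ⟨z, hzS, hz⟩ := hx.inter_open_nonempty S hSo ⟨y, hyS⟩
  let m : orbitModule O x := ⟨delta z 1, delta_mem_orbitModule hz 1⟩
  have ham : conv a.1 (delta z 1) = 0 := congrArg Subtype.val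
    (DFunLike.congr_fun ((TwoSidedIdeal.mem_ker _).1 haker) m)
  have haz : conv a.1 (delta z 1) (arr (𝟙 z)) = a.1 (arr (𝟙 z)) := by
    rw [diag_conv (eq_zero_of_mem_gammaOn had), delta_apply, mul_one]
  exact hS hzS (haz.symm.trans (congrFun ham _))

theorem isLeftPrimitive_of_dense_orbit (hO : O.IsSheafOfFields)
    (hmax : IsMaximalCommutative (diagonal O)) {x : X} (hx : Dense (orbit x)) :
    IsLeftPrimitive (Gamma O) := by
  refine ⟨orbitModule O x, inferInstance, orbitAction O x, orbitAction_injective hO hmax hx, ?_,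
    eq_bot_or_eq_top_of_orbitAction_mem hO⟩
  have := (hO x).nontrivial
  have hxx : x ∈ orbit x := mem_orbit.2 ⟨𝟙 x⟩
  let m : orbitModule O x := ⟨delta x 1, delta_mem_orbitModule hxx 1⟩
  have hm : m ≠ 0 := fun h => delta_ne_zero one_ne_zero (congrArg Subtype.val h)
  obtain ⟨f, hf⟩ := exists_orbitAction_eq_delta hO hm hxx 1
  exact ⟨f, m, fun h => delta_ne_zero one_ne_zero (hf.symm.trans (congrArg Subtype.val h))⟩

end OrbitModule

end GroupoidAlg

theorem theoremt {X : Type u} [CategoryTheory.Groupoid.{v} X] [TopologicalSpace X]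
    [TopologicalSpace (GroupoidAlg.Arr X)] [GroupoidAlg.IsAmple X]
    (O : GroupoidAlg.SheafOfRings.{u, v, w} X) (hO : O.IsSheafOfFields)
    (hmax : GroupoidAlg.IsMaximalCommutative (GroupoidAlg.diagonal O)) :
    GroupoidAlg.IsLeftPrimitive (GroupoidAlg.Gamma O) ↔
      ∃ x : X, Dense (GroupoidAlg.orbit x) := by
  have := fun x => (hO x).nontrivial
  exact ⟨GroupoidAlg.exists_dense_orbit_of_isLeftPrimitive,
    fun ⟨_, hx⟩ => GroupoidAlg.isLeftPrimitive_of_dense_orbit hO hmax hx⟩
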